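/- Let $\mathcal L$ be a finite distributive lattice with least element $0$ and greatest element $1$, $0\neq 1$, regarded as a Heyting algebra with implication $\to$. For $\ell\in\mathcal L$ let $T_\ell:\mathcal L\to\mathcal L$ be given by $T_\ell(x)=1$ if $x=\ell$ and $T_\ell(x)=0$ otherwise. A subalgebra of $\mathcal L$ is a subset that contains $0,1$ and is closed under $\wedge,\vee,\to$ and all $T_\ell$; $\mathfrak S_{\mathcal L}$ is the set of subalgebras. **Algebras.** An $\mathcal L$-$\mathcal{VL}$-algebra is a Heyting algebra $A$ with unary operations $T_\ell$ ($\ell\in\mathcal L$) such that for all $a,b\in A$ and $\ell,\ell_1,\ell_2\in\mathcal L$: - $T_{\ell_1}(a)\wedge T_{\ell_2}(b)\le T_{\ell_1\to\ell_2}(a\to b)\wedge T_{\ell_1\wedge\ell_2}(a\wedge b)\wedge T_{\ell_1\vee\ell_2}(a\vee b)$ and $T_{\ell_2}(a)\le T_{T_{\ell_1}(\ell_2)}(T_{\ell_1}(a))$; - $T_0(0)=1$, $T_\ell(0)=0$ for $\ell\ne0$, $T_1(1)=1$, $T_\ell(1)=0$ for $\ell\neq1$; - $\bigvee_{\ell}T_\ell(a)=1$,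 $T_\ell(a)\vee(T_\ell(a)\to0)=1$, and $T_{\ell_1}(a)\wedge T_{\ell_2}(a)=0$ for $\ell_1\ne\ell_2$; - $T_1(T_\ell(a))=T_\ell(a)$, $T_0(T_\ell(a))=T_\ell(a)\to0$, and $T_{\ell_2}(T_{\ell_1}(a))=0$ for $\ell_2\ne0,1$; - $T_1(a)\le a$ and $T_1(a\wedge b)=T_1(a)\wedge T_1(b)$; - $\bigwedge_\ell(T_\ell(a)\leftrightarrow T_\ell(b))\le(a\leftrightarrow b)$. An $\mathcal L$-$\mathcal{ML}$-algebra is an $\mathcal L$-$\mathcal{VL}$-algebra with a unary operation $\Box$ such that $\Box(a\wedge b)=\Box a\wedge\Box b$ and $\Box U_\ell(a)=U_\ell(\Box a)$ for all $\ell\in\mathcal L$, where $U_\ell(a)=\bigvee\{T_{\ell'}(a):\ell\le\ell'\}$. Homomorphisms preserve all the operations. $\mathcal{MA}_{\mathcal L}$ is the category of $\mathcal L$-$\mathcal{ML}$-algebras, and $\mathrm{Hom}(A,S)$ is the set of $\mathcal L$-$\mathcal{VL}$-homomorphisms $A\to\mathcal L$ with values in $S\in\mathfrak S_{\mathcal L}$.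 **Spaces.** For a set $P$ with topologies $\tau_1,\tau_2$ let $\beta_1$ be the family of $\tau_1$-open $\tau_2$-closed sets and $\beta_2$ the family of $\tau_2$-open $\tau_1$-closed sets. A subset is pairwise compact (pairwise closed) if it is compact (closed) in the join $\tau_1\vee\tau_2$. The space is pairwise Boolean if (a) for every ordered pair $(x,y)$ of distinct points there are disjoint $U\in\tau_1$, $V\in\tau_2$ with $x\in U$, $y\in V$; (b) $\beta_i$ is a basis of $\tau_i$ for $i=1,2$; (c) $P$ is pairwise compact. An object of $PRBS_{\mathcal L}$ is a pairwise Boolean space $P$ with a map $\alpha_P$ from $\mathfrak S_{\mathcal L}$ to the pairwise closed subsets of $P$ such that $\alpha_P(\mathcal L)=P$ and $\alpha_P(S_1\cap S_2)=\alpha_P(S_1)\cap\alpha_P(S_2)$, and a binary relation $R$ on $P$ such that, with $R[p]=\{q:pRq\}$: every $R[p]$ is pairwise compact; for every $C\in\beta_1$ the sets $[R]C=\{p:R[p]\subseteq C\}$ and $\langle R\rangle C=\{p:R[p]\cap C\neq\emptyset\}$ belong to $\beta_1$; and $m\in\alpha_P(S)$ implies $R[m]\subseteq\alpha_P(S)$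 for all $S\in\mathfrak S_{\mathcal L}$. An arrow $f:P\to P'$ is a map that is continuous for both pairs of topologies $(\tau_i,\tau_i')$, maps $\alpha_P(S)$ into $\alpha_{P'}(S)$ for all $S$, satisfies $f(p_1)R'f(p_2)$ whenever $p_1Rp_2$, and is such that $f(p)R'p'$ implies $p'=f(p^*)$ for some $p^*\in R[p]$. **Functors.** For $A$ in $\mathcal{MA}_{\mathcal L}$ let $\mathcal G(A)$ be the set $\mathrm{Hom}(A,\mathcal L)$ with $\tau_1$ generated by the sets $\langle a\rangle=\{h:h(a)=1\}$, $a\in A$, with $\tau_2$ generated by their complements, with $\alpha_A(S)=\mathrm{Hom}(A,S)$, and with the relation $\psi R_\Box\phi$ iff for all $\ell\in\mathcal L$, $a\in A$: $\psi(\Box a)\ge\ell$ implies $\phi(a)\ge\ell$. For $P$ in $PRBS_{\mathcal L}$ let $\mathcal F(P)$ be the set of maps $f:P\to\mathcal L$ that are continuous for both topologies of $P$ and the discrete topology of $\mathcal L$ and satisfy $f(\alpha_P(S))\subseteq S$ for all $S\in\mathfrak S_{\mathcal L}$, with the pointwise operations and $(\Box_Rf)(x)=\bigwedge\{f(y):xRy\}$.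 On arrows both $\mathcal G$ and $\mathcal F$ act by composition, $\phi\mapsto\phi\circ\psi$. **Theorem.** $\mathcal G:\mathcal{MA}_{\mathcal L}\to PRBS_{\mathcal L}$ and $\mathcal F:PRBS_{\mathcal L}\to\mathcal{MA}_{\mathcal L}$ are well-defined contravariant functors and form a dual equivalence between the categories $\mathcal{MA}_{\mathcal L}$ and $PRBS_{\mathcal L}$. The maps $\gamma^A:A\to\mathcal F\mathcal G(A)$, $\gamma^A(a)(g)=g(a)$, form a natural isomorphism from the identity of $\mathcal{MA}_{\mathcal L}$ to $\mathcal F\circ\mathcal G$, and the maps $\zeta_P:P\to\mathcal G\mathcal F(P)$, $\zeta_P(p)(\psi)=\psi(p)$, form a natural isomorphism from the identity of $PRBS_{\mathcal L}$ to $\mathcal G\circ\mathcal F$. -/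

import Mathlib

open CategoryTheory Topology

universe u

namespace FittingModal

noncomputable section

/-! ## Algebras of Heyting-valued logic -/

/-- The operation `T_l` on the lattice of truth values: `T_l(x) = 1` if `x = l`, and
`T_l(x) = 0` otherwise. -/
def charT {L : Type u} [HeytingAlgebra L] (l x : L) : L :=
  open Classical in if x = l then ⊤ else ⊥

/-- `L`-`VL`-algebras: a Heyting algebra `A` with unary operations `T_l`, `l ∈ L`. -/
class LVLAlgebra (L : Type u) [HeytingAlgebra L] [Fintype L] (A : Type u) [HeytingAlgebra A] where
  T : L → A → A
  T_binary : ∀ (l₁ l₂ : L) (a b : A),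
    T l₁ a ⊓ T l₂ b ≤ T (l₁ ⇨ l₂) (a ⇨ b) ⊓ T (l₁ ⊓ l₂) (a ⊓ b) ⊓ T (l₁ ⊔ l₂) (a ⊔ b)
  T_unary : ∀ (l₁ l₂ : L) (a : A), T l₂ a ≤ T (charT l₁ l₂) (T l₁ a)
  T_bot_bot : T ⊥ ⊥ = ⊤
  T_of_ne_bot : ∀ l : L, l ≠ ⊥ → T l ⊥ = ⊥
  T_top_top : T ⊤ ⊤ = ⊤
  T_of_ne_top : ∀ l : L, l ≠ ⊤ → T l ⊤ = ⊥
  sup_T : ∀ a : A, Finset.univ.sup (fun l => T l a) = ⊤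
  T_sup_compl : ∀ (l : L) (a : A), T l a ⊔ (T l a ⇨ ⊥) = ⊤
  T_inf_T : ∀ (l₁ l₂ : L) (a : A), l₁ ≠ l₂ → T l₁ a ⊓ T l₂ a = ⊥
  T_top_T : ∀ (l : L) (a : A), T ⊤ (T l a) = T l a
  T_bot_T : ∀ (l : L) (a : A), T ⊥ (T l a) = (T l a ⇨ ⊥)
  T_mid_T : ∀ (l₁ l₂ : L) (a : A), l₂ ≠ ⊥ → l₂ ≠ ⊤ → T l₂ (T l₁ a) = ⊥
  T_top_le : ∀ a : A, T ⊤ a ≤ a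
  T_top_inf : ∀ a b : A, T ⊤ (a ⊓ b) = T ⊤ a ⊓ T ⊤ b
  inf_T_le : ∀ a b : A,
    Finset.univ.inf (fun l => (T l a ⇨ T l b) ⊓ (T l b ⇨ T l a)) ≤ (a ⇨ b) ⊓ (b ⇨ a)

/-- The operation `U_l(a) = ⋁ {T_{l'}(a) : l ≤ l'}`. -/
def opU {L : Type u} [HeytingAlgebra L] [Fintype L] {A : Type u} [HeytingAlgebra A]
    [LVLAlgebra L A] (l : L) (a : A) : A :=
  open Classical in
  (Finset.univ.filter (fun l' : L => l ≤ l')).sup (fun l' => LVLAlgebra.T l' a)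

/-- `L`-`ML`-algebras: `L`-`VL`-algebras with a modal operation. -/
class LMLAlgebra (L : Type u) [HeytingAlgebra L] [Fintype L] (A : Type u) [HeytingAlgebra A]
    extends LVLAlgebra L A where
  box : A → A
  box_inf : ∀ a b : A, box (a ⊓ b) = box a ⊓ box b
  box_opU : ∀ (l : L) (a : A), box (opU l a) = opU l (box a)

/-- Homomorphisms of `L`-`VL`-algebras. -/
@[ext]
structure VLHom (L : Type u) [HeytingAlgebra L] [Fintype L] (A B : Type u)
    [HeytingAlgebra A] [HeytingAlgebra B] [LVLAlgebra L A] [LVLAlgebra L B] where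
  toFun : A → B
  map_sup : ∀ a b, toFun (a ⊔ b) = toFun a ⊔ toFun b
  map_inf : ∀ a b, toFun (a ⊓ b) = toFun a ⊓ toFun b
  map_himp : ∀ a b, toFun (a ⇨ b) = toFun a ⇨ toFun b
  map_T : ∀ (l : L) (a : A), toFun (LVLAlgebra.T l a) = LVLAlgebra.T l (toFun a)
  map_bot : toFun ⊥ = ⊥
  map_top : toFun ⊤ = ⊤

/-- Composition of homomorphisms of `L`-`VL`-algebras. -/
def VLHom.comp {L : Type u} [HeytingAlgebra L] [Fintype L] {A B C : Type u}
    [HeytingAlgebra A] [HeytingAlgebra B] [HeytingAlgebra C]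
    [LVLAlgebra L A] [LVLAlgebra L B] [LVLAlgebra L C]
    (g : VLHom L B C) (f : VLHom L A B) : VLHom L A C where
  toFun a := g.toFun (f.toFun a)
  map_sup a b := by rw [f.map_sup, g.map_sup]
  map_inf a b := by rw [f.map_inf, g.map_inf]
  map_himp a b := by rw [f.map_himp, g.map_himp]
  map_T l a := by rw [f.map_T, g.map_T]
  map_bot := by rw [f.map_bot, g.map_bot]
  map_top := by rw [f.map_top, g.map_top]

/-- Homomorphisms of `L`-`ML`-algebras. -/
@[ext]
structure MLHom (L : Type u) [HeytingAlgebra L] [Fintype L] (A B : Type u)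
    [HeytingAlgebra A] [HeytingAlgebra B] [LMLAlgebra L A] [LMLAlgebra L B]
    extends VLHom L A B where
  map_box : ∀ a : A, toFun (LMLAlgebra.box L a) = LMLAlgebra.box L (toFun a)

/-- Objects of the category of `L`-`ML`-algebras. -/
structure MA (L : Type u) [HeytingAlgebra L] [Fintype L] where
  carrier : Type u
  [heyting : HeytingAlgebra carrier]
  [lml : LMLAlgebra L carrier]

attribute [instance] MA.heyting MA.lml

/-- The category of `L`-`ML`-algebras and their homomorphisms. -/
instance (L : Type u) [HeytingAlgebra L] [Fintype L] : Category.{u} (MA L) where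
  Hom A B := MLHom L A.carrier B.carrier
  id A :=
    { toFun := fun a => a
      map_sup := fun _ _ => rfl
      map_inf := fun _ _ => rfl
      map_himp := fun _ _ => rfl
      map_T := fun _ _ => rfl
      map_bot := rfl
      map_top := rfl
      map_box := fun _ => rfl }
  comp f g :=
    { toVLHom := g.toVLHom.comp f.toVLHom
      map_box := fun a => by
        change g.toFun (f.toFun _) = LMLAlgebra.box L (g.toFun (f.toFun a))
        rw [f.map_box, g.map_box] }

theorem charT_self {L : Type u} [HeytingAlgebra L] (l : L) : charT l l = ⊤ := by
  simp [charT]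

theorem charT_of_ne {L : Type u} [HeytingAlgebra L] {l x : L} (h : x ≠ l) : charT l x = ⊥ := by
  simp [charT, h]

theorem charT_cases {L : Type u} [HeytingAlgebra L] (l x : L) :
    charT l x = ⊤ ∨ charT l x = ⊥ := by
  unfold charT; split_ifs <;> simp

/-- The lattice of truth values is itself an `L`-`VL`-algebra. -/
instance selfLVL (L : Type u) [HeytingAlgebra L] [Fintype L] : LVLAlgebra L L where
  T := charT
  T_binary l₁ l₂ a b := by
    by_cases h₁ : a = l₁
    · by_cases h₂ : b = l₂
      · subst h₁ h₂; simp [charT_self]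
      · simp [charT_of_ne h₂]
    · simp [charT_of_ne h₁]
  T_unary l₁ l₂ a := by
    by_cases h : a = l₂
    · subst h; simp [charT_self]
    · simp [charT_of_ne h]
  T_bot_bot := charT_self _
  T_of_ne_bot l h := charT_of_ne h.symm
  T_top_top := charT_self _
  T_of_ne_top l h := charT_of_ne h.symm
  sup_T a := top_unique <| by
    have := Finset.le_sup (f := fun l : L => charT l a) (Finset.mem_univ a)
    rwa [charT_self] at this
  T_sup_compl l a := by rcases charT_cases l a with h | h <;> simp [h]
  T_inf_T l₁ l₂ a h := by
    by_cases h₁ : a = l₁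
    · subst h₁; simp [charT_of_ne h]
    · simp [charT_of_ne h₁]
  T_top_T l a := by
    rcases charT_cases l a with h | h <;> rw [h]
    · exact charT_self _
    · by_cases hb : (⊥ : L) = ⊤
      · rw [← hb]; exact (charT_self _).trans hb.symm
      · exact charT_of_ne hb
  T_bot_T l a := by
    rcases charT_cases l a with h | h <;> rw [h]
    · by_cases hb : (⊤ : L) = ⊥
      · rw [hb, charT_self]; simp
      · rw [charT_of_ne hb]; simp
    · rw [charT_self]; simp
  T_mid_T l₁ l₂ a h0 h1 := by
    rcases charT_cases l₁ a with h | h <;> rw [h]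
    · exact charT_of_ne h1.symm
    · exact charT_of_ne h0.symm
  T_top_le a := by
    by_cases h : a = ⊤
    · subst h; exact le_top
    · simp [charT_of_ne h]
  T_top_inf a b := by
    by_cases ha : a = ⊤
    · subst ha; simp [charT_self]
    · have : a ⊓ b ≠ ⊤ := fun h => ha (inf_eq_top_iff.1 h).1
      simp [charT_of_ne ha, charT_of_ne this]
  inf_T_le a b := by
    by_cases h : b = a
    · subst h; simp
    · refine (Finset.inf_le (Finset.mem_univ a)).trans ?_
      simp [charT_self, charT_of_ne h]

/-- Subalgebras of the algebra of truth values. -/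
@[ext]
structure SubAlg (L : Type u) [HeytingAlgebra L] where
  carrier : Set L
  sup_mem : ∀ a ∈ carrier, ∀ b ∈ carrier, a ⊔ b ∈ carrier
  inf_mem : ∀ a ∈ carrier, ∀ b ∈ carrier, a ⊓ b ∈ carrier
  himp_mem : ∀ a ∈ carrier, ∀ b ∈ carrier, a ⇨ b ∈ carrier
  T_mem : ∀ l : L, ∀ a ∈ carrier, charT l a ∈ carrier
  bot_mem : ⊥ ∈ carrier
  top_mem : ⊤ ∈ carrier

/-- The whole algebra as a subalgebra of itself. -/
instance (L : Type u) [HeytingAlgebra L] : Top (SubAlg L) where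
  top :=
    { carrier := Set.univ
      sup_mem := fun _ _ _ _ => trivial
      inf_mem := fun _ _ _ _ => trivial
      himp_mem := fun _ _ _ _ => trivial
      T_mem := fun _ _ _ => trivial
      bot_mem := trivial
      top_mem := trivial }

/-- The intersection of two subalgebras. -/
instance (L : Type u) [HeytingAlgebra L] : Min (SubAlg L) where
  min S₁ S₂ :=
    { carrier := S₁.carrier ∩ S₂.carrier
      sup_mem := fun a ha b hb => ⟨S₁.sup_mem a ha.1 b hb.1, S₂.sup_mem a ha.2 b hb.2⟩
      inf_mem := fun a ha b hb => ⟨S₁.inf_mem a ha.1 b hb.1, S₂.inf_mem a ha.2 b hb.2⟩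
      himp_mem := fun a ha b hb => ⟨S₁.himp_mem a ha.1 b hb.1, S₂.himp_mem a ha.2 b hb.2⟩
      T_mem := fun l a ha => ⟨S₁.T_mem l a ha.1, S₂.T_mem l a ha.2⟩
      bot_mem := ⟨S₁.bot_mem, S₂.bot_mem⟩
      top_mem := ⟨S₁.top_mem, S₂.top_mem⟩ }

/-! ## Bitopological spaces -/

/-- Every ordered pair of distinct points `x`, `y` is separated by disjoint sets, a `t₁`-open one
around `x` and a `t₂`-open one around `y`. -/
def PairwiseHausdorff {X : Type u} (t₁ t₂ : TopologicalSpace X) : Prop :=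
  ∀ x y : X, x ≠ y → ∃ U V : Set X, IsOpen[t₁] U ∧ IsOpen[t₂] V ∧ x ∈ U ∧ y ∈ V ∧ Disjoint U V

/-- The family of sets that are `t₁`-open and `t₂`-closed: `beta t₁ t₂` is `β₁`, and `beta t₂ t₁`
is `β₂`. -/
def beta {X : Type u} (t₁ t₂ : TopologicalSpace X) : Set (Set X) :=
  {C | IsOpen[t₁] C ∧ IsClosed[t₂] C}

/-- `β₁` is a basis of `t₁` and `β₂` is a basis of `t₂`. -/
def PairwiseZeroDimensional {X : Type u} (t₁ t₂ : TopologicalSpace X) : Prop :=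
  @TopologicalSpace.IsTopologicalBasis X t₁ (beta t₁ t₂) ∧
    @TopologicalSpace.IsTopologicalBasis X t₂ (beta t₂ t₁)

/-- The topology generated by the union of two topologies (the order on topologies in Mathlib
makes it the infimum). -/
abbrev joinTop {X : Type u} (t₁ t₂ : TopologicalSpace X) : TopologicalSpace X := t₁ ⊓ t₂

/-- A subset is pairwise compact if it is compact in the join of the two topologies. -/
def IsPairwiseCompact {X : Type u} (t₁ t₂ : TopologicalSpace X) (C : Set X) : Prop :=
  @IsCompact X (joinTop t₁ t₂) C

/-- A subset is pairwise closed if it is closed in the join of the two topologies. -/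
def IsPairwiseClosed {X : Type u} (t₁ t₂ : TopologicalSpace X) (C : Set X) : Prop :=
  IsClosed[joinTop t₁ t₂] C

/-- Pairwise Boolean spaces. -/
structure IsPairwiseBoolean {X : Type u} (t₁ t₂ : TopologicalSpace X) : Prop where
  hausdorff : PairwiseHausdorff t₁ t₂
  zeroDimensional : PairwiseZeroDimensional t₁ t₂
  compact : IsPairwiseCompact t₁ t₂ Set.univ

/-- A set with two topologies and a subset `α S` for every subalgebra `S` of `L`. -/
structure SpaceData (L : Type u) [HeytingAlgebra L] where
  carrier : Type u
  t₁ : TopologicalSpace carrier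
  t₂ : TopologicalSpace carrier
  α : SubAlg L → Set carrier

/-- Objects of the category of `L`-valued pairwise Boolean spaces. -/
structure IsPBS {L : Type u} [HeytingAlgebra L] (B : SpaceData L) : Prop where
  boolean : IsPairwiseBoolean B.t₁ B.t₂
  closed : ∀ S : SubAlg L, IsPairwiseClosed B.t₁ B.t₂ (B.α S)
  α_top : B.α ⊤ = Set.univ
  α_inf : ∀ S₁ S₂ : SubAlg L, B.α (S₁ ⊓ S₂) = B.α S₁ ∩ B.α S₂

/-- Arrows of the category of `L`-valued pairwise Boolean spaces: pairwise continuous maps that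
preserve the subspaces `α S`. -/
structure IsPBSHom {L : Type u} [HeytingAlgebra L] (B C : SpaceData L)
    (f : B.carrier → C.carrier) : Prop where
  continuous₁ : Continuous[B.t₁, C.t₁] f
  continuous₂ : Continuous[B.t₂, C.t₂] f
  map_α : ∀ (S : SubAlg L) (x : B.carrier), x ∈ B.α S → f x ∈ C.α S

/-- `L` with the discrete topology taken twice and `α S = S`. -/
abbrev valueSpace (L : Type u) [HeytingAlgebra L] : SpaceData L where
  carrier := L
  t₁ := ⊥
  t₂ := ⊥
  α S := S.carrier

/-! ## Spaces with a relation -/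

/-- The data of an `L`-valued bitopological space with a binary relation. -/
structure FrameData (L : Type u) [HeytingAlgebra L] extends SpaceData L where
  R : carrier → carrier → Prop

/-- `[R]C`, the set of points all of whose successors lie in `C`. -/
def boxSet {X : Type u} (R : X → X → Prop) (C : Set X) : Set X := {p | {q | R p q} ⊆ C}

/-- `⟨R⟩C`, the set of points that have a successor in `C`. -/
def diaSet {X : Type u} (R : X → X → Prop) (C : Set X) : Set X := {p | ({q | R p q} ∩ C).Nonempty}

/-- The conditions on an object of `PRBS L`. -/
structure IsPRBS {L : Type u} [HeytingAlgebra L] (P : FrameData L) : Prop where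
  isPBS : IsPBS P.toSpaceData
  compact : ∀ p, IsPairwiseCompact P.t₁ P.t₂ {q | P.R p q}
  box_mem : ∀ C ∈ beta P.t₁ P.t₂, boxSet P.R C ∈ beta P.t₁ P.t₂
  dia_mem : ∀ C ∈ beta P.t₁ P.t₂, diaSet P.R C ∈ beta P.t₁ P.t₂
  α_succ : ∀ (S : SubAlg L) (m), m ∈ P.α S → {q | P.R m q} ⊆ P.α S

/-- The conditions on an arrow of `PRBS L`. -/
structure IsPRBSHom {L : Type u} [HeytingAlgebra L] (P Q : FrameData L)
    (f : P.carrier → Q.carrier) : Prop where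
  isPBSHom : IsPBSHom P.toSpaceData Q.toSpaceData f
  forth : ∀ p₁ p₂, P.R p₁ p₂ → Q.R (f p₁) (f p₂)
  back : ∀ p q, Q.R (f p) q → ∃ p', P.R p p' ∧ f p' = q

/-- Objects of the category of `L`-valued pairwise Boolean spaces with a relation. -/
structure PRBS (L : Type u) [HeytingAlgebra L] extends FrameData L where
  isPRBS : IsPRBS toFrameData

/-- Arrows of the category of `L`-valued pairwise Boolean spaces with a relation. -/
@[ext]
structure PRBSHom {L : Type u} [HeytingAlgebra L] (P Q : PRBS L) where
  toFun : P.carrier → Q.carrier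
  isPRBSHom : IsPRBSHom P.toFrameData Q.toFrameData toFun

theorem IsPBSHom.comp {L : Type u} [HeytingAlgebra L] {B C D : SpaceData L}
    {g : C.carrier → D.carrier} {f : B.carrier → C.carrier}
    (hg : IsPBSHom C D g) (hf : IsPBSHom B C f) : IsPBSHom B D (fun x => g (f x)) where
  continuous₁ := by
    let := B.t₁; let := C.t₁; let := D.t₁
    exact hg.continuous₁.comp hf.continuous₁
  continuous₂ := by
    let := B.t₂; let := C.t₂; let := D.t₂
    exact hg.continuous₂.comp hf.continuous₂
  map_α S x hx := hg.map_α S _ (hf.map_α S x hx)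

/-- The category of `L`-valued pairwise Boolean spaces with a relation. -/
instance (L : Type u) [HeytingAlgebra L] : Category.{u} (PRBS L) where
  Hom P Q := PRBSHom P Q
  id P :=
    { toFun := fun p => p
      isPRBSHom :=
        { isPBSHom :=
            { continuous₁ := by let := P.t₁; exact continuous_id
              continuous₂ := by let := P.t₂; exact continuous_id
              map_α := fun _ _ h => h }
          forth := fun _ _ h => h
          back := fun _ q h => ⟨q, h, rfl⟩ } }
  comp f g :=
    { toFun := fun p => g.toFun (f.toFun p)
      isPRBSHom :=
        { isPBSHom := g.isPRBSHom.isPBSHom.comp f.isPRBSHom.isPBSHom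
          forth := fun p₁ p₂ h => g.isPRBSHom.forth _ _ (f.isPRBSHom.forth p₁ p₂ h)
          back := fun p q h => by
            obtain ⟨y, hy, rfl⟩ := g.isPRBSHom.back _ q h
            obtain ⟨x, hx, rfl⟩ := f.isPRBSHom.back _ y hy
            exact ⟨x, hx, rfl⟩ } }

/-! ## The functor from algebras to spaces -/

/-- The canonical frame of an `L`-`ML`-algebra `A`: the set of all `VL`-homomorphisms `A → L`, with
the topologies generated by the sets `⟨a⟩ = {h : h(a) = 1}` and by their complements, the subsets
of homomorphisms with values in `S`, and the relation `R_□`. -/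
def canonicalFrame {L : Type u} [HeytingAlgebra L] [Fintype L] (A : MA L) : FrameData L where
  carrier := VLHom L A.carrier L
  t₁ := TopologicalSpace.generateFrom {U | ∃ a : A.carrier, U = {h | h.toFun a = ⊤}}
  t₂ := TopologicalSpace.generateFrom {U | ∃ a : A.carrier, U = {h | h.toFun a = ⊤}ᶜ}
  α S := {h | ∀ a, h.toFun a ∈ S.carrier}
  R ψ φ := ∀ (l : L) (a : A.carrier), l ≤ ψ.toFun (LMLAlgebra.box L a) → l ≤ φ.toFun a

/-- Composition with a homomorphism `ψ`, as a map of canonical frames. -/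
def canonicalMap {L : Type u} [HeytingAlgebra L] [Fintype L] {A B : MA L} (ψ : A ⟶ B) :
    (canonicalFrame B).carrier → (canonicalFrame A).carrier :=
  fun φ : VLHom L B.carrier L => φ.comp (MLHom.toVLHom ψ)

/-- The contravariant functor that sends an algebra to its canonical frame and a homomorphism to
composition with it. That these are objects and arrows of `PRBS L` has to be supplied. -/
def functorG {L : Type u} [HeytingAlgebra L] [Fintype L]
    (hobj : ∀ A : MA L, IsPRBS (canonicalFrame A))
    (hmap : ∀ (A B : MA L) (ψ : A ⟶ B),
      IsPRBSHom (canonicalFrame B) (canonicalFrame A) (canonicalMap ψ)) :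
    (MA L)ᵒᵖ ⥤ PRBS L where
  obj A := { toFrameData := canonicalFrame A.unop, isPRBS := hobj A.unop }
  map {A B} ψ := { toFun := canonicalMap ψ.unop, isPRBSHom := hmap B.unop A.unop ψ.unop }

/-! ## The functor from spaces to algebras -/

/-- `(□_R f)(x) = ⋀ {f(y) : x R y}`. -/
def boxFun {L : Type u} [HeytingAlgebra L] [Fintype L] {X : Type u} (R : X → X → Prop)
    (f : X → L) (x : X) : L :=
  open Classical in (Finset.univ.filter (fun l : L => ∃ y, R x y ∧ f y = l)).inf (fun l => l)

theorem le_boxFun {L : Type u} [HeytingAlgebra L] [Fintype L] {X : Type u} {R : X → X → Prop}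
    {f : X → L} {x : X} {l : L} : l ≤ boxFun R f x ↔ ∀ y, R x y → l ≤ f y := by
  classical
  simp only [boxFun, Finset.le_inf_iff, Finset.mem_filter, Finset.mem_univ, true_and]
  constructor
  · exact fun h y hy => h _ ⟨y, hy, rfl⟩
  · rintro h _ ⟨y, hy, rfl⟩; exact h y hy

/-- Arrows from a space to `L`. -/
@[ext]
structure ValMap {L : Type u} [HeytingAlgebra L] (B : SpaceData L) where
  toFun : B.carrier → L
  isPBSHom : IsPBSHom B (valueSpace L) toFun

section Operations

variable {L : Type u} [HeytingAlgebra L]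

theorem isPBSHom_const (B : SpaceData L) (c : L) (hc : ∀ S : SubAlg L, c ∈ S.carrier) :
    IsPBSHom B (valueSpace L) (fun _ => c) where
  continuous₁ := by let := B.t₁; let := (valueSpace L).t₁; exact continuous_const
  continuous₂ := by let := B.t₂; let := (valueSpace L).t₂; exact continuous_const
  map_α S _ _ := hc S

theorem continuous_op₂ {M X : Type u} (t : TopologicalSpace X) (op : M → M → M) {f g : X → M}
    (hf : Continuous[t, ⊥] f) (hg : Continuous[t, ⊥] g) :
    Continuous[t, ⊥] (fun x => op (f x) (g x)) := by
  let : TopologicalSpace M := ⊥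
  have : DiscreteTopology M := ⟨rfl⟩
  exact (continuous_of_discreteTopology (f := fun p : M × M => op p.1 p.2)).comp
    (hf.prodMk hg)

theorem isPBSHom_op₂ {B : SpaceData L} (op : L → L → L)
    (hop : ∀ S : SubAlg L, ∀ a ∈ S.carrier, ∀ b ∈ S.carrier, op a b ∈ S.carrier)
    {f g : B.carrier → L} (hf : IsPBSHom B (valueSpace L) f) (hg : IsPBSHom B (valueSpace L) g) :
    IsPBSHom B (valueSpace L) (fun x => op (f x) (g x)) where
  continuous₁ := continuous_op₂ B.t₁ op hf.continuous₁ hg.continuous₁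
  continuous₂ := continuous_op₂ B.t₂ op hf.continuous₂ hg.continuous₂
  map_α S x hx := hop S _ (hf.map_α S x hx) _ (hg.map_α S x hx)

/-- The Heyting algebra of arrows to `L`, with the pointwise operations. -/
instance (B : SpaceData L) : HeytingAlgebra (ValMap B) where
  le f g := ∀ x, f.toFun x ≤ g.toFun x
  le_refl f x := le_rfl
  le_trans f g h h₁ h₂ x := (h₁ x).trans (h₂ x)
  le_antisymm f g h₁ h₂ := ValMap.ext (funext fun x => le_antisymm (h₁ x) (h₂ x))
  sup f g := ⟨fun x => f.toFun x ⊔ g.toFun x,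
    isPBSHom_op₂ (· ⊔ ·) SubAlg.sup_mem f.isPBSHom g.isPBSHom⟩
  inf f g := ⟨fun x => f.toFun x ⊓ g.toFun x,
    isPBSHom_op₂ (· ⊓ ·) SubAlg.inf_mem f.isPBSHom g.isPBSHom⟩
  himp f g := ⟨fun x => f.toFun x ⇨ g.toFun x,
    isPBSHom_op₂ (· ⇨ ·) SubAlg.himp_mem f.isPBSHom g.isPBSHom⟩
  compl f := ⟨fun x => f.toFun x ⇨ ⊥, isPBSHom_op₂ (fun a _ : L => a ⇨ (⊥ : L))
    (fun S a ha _ _ => S.himp_mem a ha ⊥ S.bot_mem) f.isPBSHom f.isPBSHom⟩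
  top := ⟨fun _ => ⊤, isPBSHom_const B ⊤ SubAlg.top_mem⟩
  bot := ⟨fun _ => ⊥, isPBSHom_const B ⊥ SubAlg.bot_mem⟩
  le_sup_left _ _ _ := le_sup_left
  le_sup_right _ _ _ := le_sup_right
  sup_le _ _ _ h₁ h₂ x := sup_le (h₁ x) (h₂ x)
  inf_le_left _ _ _ := inf_le_left
  inf_le_right _ _ _ := inf_le_right
  le_inf _ _ _ h₁ h₂ x := le_inf (h₁ x) (h₂ x)
  le_top _ _ := le_top
  bot_le _ _ := bot_le
  le_himp_iff _ _ _ := forall_congr' fun _ => le_himp_iff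
  himp_bot _ := rfl

theorem ValMap.sup_apply {B : SpaceData L} {ι : Type u} (s : Finset ι) (f : ι → ValMap B)
    (x : B.carrier) : (s.sup f).toFun x = s.sup (fun i => (f i).toFun x) :=
  Finset.apply_sup_eq_sup_comp (fun g : ValMap B => g.toFun x) (fun _ _ => rfl) rfl

theorem ValMap.inf_apply {B : SpaceData L} {ι : Type u} (s : Finset ι) (f : ι → ValMap B)
    (x : B.carrier) : (s.inf f).toFun x = s.inf (fun i => (f i).toFun x) :=
  Finset.apply_inf_eq_inf_comp (fun g : ValMap B => g.toFun x) (fun _ _ => rfl) rfl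

variable [Fintype L]

/-- The pointwise operations `T_l` on the arrows to `L`. -/
instance (B : SpaceData L) : LVLAlgebra L (ValMap B) where
  T l f := ⟨fun x => charT l (f.toFun x), isPBSHom_op₂ (fun a _ : L => charT l a)
    (fun S a ha _ _ => S.T_mem l a ha) f.isPBSHom f.isPBSHom⟩
  T_binary l₁ l₂ a b := fun x => (selfLVL L).T_binary l₁ l₂ (a.toFun x) (b.toFun x)
  T_unary l₁ l₂ a := fun x => (selfLVL L).T_unary l₁ l₂ (a.toFun x)
  T_bot_bot := ValMap.ext (funext fun _ => (selfLVL L).T_bot_bot)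
  T_of_ne_bot l h := ValMap.ext (funext fun _ => (selfLVL L).T_of_ne_bot l h)
  T_top_top := ValMap.ext (funext fun _ => (selfLVL L).T_top_top)
  T_of_ne_top l h := ValMap.ext (funext fun _ => (selfLVL L).T_of_ne_top l h)
  sup_T a := ValMap.ext (funext fun x => by
    rw [ValMap.sup_apply]; exact (selfLVL L).sup_T (a.toFun x))
  T_sup_compl l a := ValMap.ext (funext fun x => (selfLVL L).T_sup_compl l (a.toFun x))
  T_inf_T l₁ l₂ a h := ValMap.ext (funext fun x => (selfLVL L).T_inf_T l₁ l₂ (a.toFun x) h)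
  T_top_T l a := ValMap.ext (funext fun x => (selfLVL L).T_top_T l (a.toFun x))
  T_bot_T l a := ValMap.ext (funext fun x => (selfLVL L).T_bot_T l (a.toFun x))
  T_mid_T l₁ l₂ a h0 h1 := ValMap.ext (funext fun x => (selfLVL L).T_mid_T l₁ l₂ (a.toFun x) h0 h1)
  T_top_le a := fun x => (selfLVL L).T_top_le (a.toFun x)
  T_top_inf a b := ValMap.ext (funext fun x => (selfLVL L).T_top_inf (a.toFun x) (b.toFun x))
  inf_T_le a b := fun x => by
    rw [ValMap.inf_apply]; exact (selfLVL L).inf_T_le (a.toFun x) (b.toFun x)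

theorem opU_self (l x : L) : opU l x = (open Classical in if l ≤ x then ⊤ else ⊥) := by
  classical
  split_ifs with h
  · refine top_unique ?_
    have : (⊤ : L) = LVLAlgebra.T x x := (charT_self x).symm
    rw [this]
    exact Finset.le_sup (f := fun l' : L => LVLAlgebra.T l' x)
      (Finset.mem_filter.2 ⟨Finset.mem_univ x, h⟩)
  · refine bot_unique (Finset.sup_le fun l' hl' => ?_)
    have : x ≠ l' := fun e => h (e ▸ (Finset.mem_filter.1 hl').2)
    exact (charT_of_ne this).le

theorem opU_apply {B : SpaceData L} (l : L) (f : ValMap B) (x : B.carrier) :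
    (opU l f).toFun x = opU l (f.toFun x) :=
  ValMap.sup_apply _ _ x

theorem boxFun_opU {X : Type u} (R : X → X → Prop) (f : X → L) (l : L) (x : X) :
    boxFun R (fun y => opU l (f y)) x = opU l (boxFun R f x) := by
  classical
  rw [opU_self]
  refine eq_of_forall_le_iff fun c => ?_
  rw [le_boxFun]
  split_ifs with h
  · rw [le_boxFun] at h
    exact ⟨fun _ => le_top, fun _ y hy => by rw [opU_self, if_pos (h y hy)]; exact le_top⟩
  · rw [le_boxFun] at h
    push Not at h
    obtain ⟨y, hy, hly⟩ := h
    refine ⟨fun hc => ?_, fun hc y _ => hc.trans bot_le⟩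
    have := hc y hy
    rwa [opU_self, if_neg hly] at this

theorem isPBSHom_boxFun (P : FrameData L) (hP : IsPRBS P) {f : P.carrier → L}
    (hf : IsPBSHom P.toSpaceData (valueSpace L) f) :
    IsPBSHom P.toSpaceData (valueSpace L) (boxFun P.R f) := by
  classical
  have pre₁ (s : Set L) : IsOpen[P.t₁] (f ⁻¹' s) := by
    let := P.t₁; let := (valueSpace L).t₁
    exact IsOpen.preimage hf.continuous₁ (show IsOpen[⊥] s from trivial)
  have pre₂ (s : Set L) : IsOpen[P.t₂] (f ⁻¹' s) := by
    let := P.t₂; let := (valueSpace L).t₂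
    exact IsOpen.preimage hf.continuous₂ (show IsOpen[⊥] s from trivial)
  have hb (s : Set L) : f ⁻¹' s ∈ beta P.t₁ P.t₂ :=
    ⟨pre₁ s, by let := P.t₂; exact ⟨pre₂ sᶜ⟩⟩
  have hbox (l : L) : boxSet P.R (f ⁻¹' Set.Ici l) = {p | l ≤ boxFun P.R f p} := by
    ext p; exact le_boxFun.symm
  have hdia (l : L) : diaSet P.R (f ⁻¹' (Set.Ici l)ᶜ) = {p | l ≤ boxFun P.R f p}ᶜ := by
    ext p
    simp only [Set.mem_compl_iff, Set.mem_ofPred_eq, le_boxFun, not_forall]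
    exact ⟨fun ⟨y, h₁, h₂⟩ => ⟨y, h₁, h₂⟩, fun ⟨y, h₁, h₂⟩ => ⟨y, h₁, h₂⟩⟩
  have key (t : TopologicalSpace P.carrier)
      (h : ∀ l, IsOpen[t] {p | l ≤ boxFun P.R f p} ∧ IsOpen[t] {p | l ≤ boxFun P.R f p}ᶜ) :
      Continuous[t, ⊥] (boxFun P.R f) := by
    let := t
    let : TopologicalSpace L := ⊥
    have : DiscreteTopology L := ⟨rfl⟩
    refine continuous_discrete_rng.2 fun l => ?_
    have : boxFun P.R f ⁻¹' {l} = ⋂ l' : L, {p | l' ≤ boxFun P.R f p ↔ l' ≤ l} := by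
      ext p
      simp only [Set.mem_preimage, Set.mem_singleton_iff, Set.mem_iInter, Set.mem_ofPred_eq]
      exact ⟨fun e _ => by rw [e], fun e => eq_of_forall_le_iff e⟩
    rw [this]
    refine isOpen_iInter_of_finite fun l' => ?_
    by_cases hl : l' ≤ l
    · simp only [hl, iff_true]; exact (h l').1
    · simp only [hl, iff_false]; exact (h l').2
  refine ⟨key P.t₁ fun l => ⟨?_, ?_⟩, key P.t₂ fun l => ⟨?_, ?_⟩, fun S x hx => ?_⟩
  · rw [← hbox]; exact (hP.box_mem _ (hb _)).1
  · rw [← hdia]; exact (hP.dia_mem _ (hb _)).1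
  · have hc := (hP.dia_mem _ (hb (Set.Ici l)ᶜ)).2
    rw [hdia] at hc
    let := P.t₂
    have h := hc.isOpen_compl
    rwa [compl_compl] at h
  · have hc := (hP.box_mem _ (hb (Set.Ici l))).2
    rw [hbox] at hc
    let := P.t₂
    exact hc.isOpen_compl
  · refine Finset.inf_induction (p := (· ∈ S.carrier)) S.top_mem S.inf_mem fun l hl => ?_
    obtain ⟨y, hy, rfl⟩ := (Finset.mem_filter.1 hl).2
    exact hf.map_α S y (hP.α_succ S x hx hy)

/-- The arrows to `L` form an `L`-`ML`-algebra with the modal operation `□_R`. -/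
instance (P : PRBS L) : LMLAlgebra L (ValMap P.toSpaceData) where
  box f := ⟨boxFun P.R f.toFun, isPBSHom_boxFun P.toFrameData P.isPRBS f.isPBSHom⟩
  box_inf f g := ValMap.ext (funext fun x => eq_of_forall_le_iff fun c => by
    change c ≤ boxFun P.R (fun y => f.toFun y ⊓ g.toFun y) x ↔
      c ≤ boxFun P.R f.toFun x ⊓ boxFun P.R g.toFun x
    simp only [le_inf_iff, le_boxFun]
    exact ⟨fun h => ⟨fun y hy => (h y hy).1, fun y hy => (h y hy).2⟩,
      fun h y hy => ⟨h.1 y hy, h.2 y hy⟩⟩)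
  box_opU l f := ValMap.ext (funext fun x => by
    rw [opU_apply]
    change boxFun P.R (opU l f).toFun x = opU l (boxFun P.R f.toFun x)
    rw [← boxFun_opU]
    congr 1
    funext y
    exact opU_apply l f y)

end Operations

/-- The contravariant functor that sends a space to the algebra of arrows from it to `L`, and an
arrow to composition with it. -/
def functorF (L : Type u) [HeytingAlgebra L] [Fintype L] : (PRBS L)ᵒᵖ ⥤ MA L where
  obj P := { carrier := ValMap P.unop.toSpaceData }
  map {P Q} ψ :=
    { toFun := fun φ => ⟨fun q => φ.toFun (ψ.unop.toFun q),
      φ.isPBSHom.comp ψ.unop.isPRBSHom.isPBSHom⟩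
      map_sup := fun _ _ => rfl
      map_inf := fun _ _ => rfl
      map_himp := fun _ _ => rfl
      map_T := fun _ _ => rfl
      map_bot := rfl
      map_top := rfl
      map_box := fun φ => ValMap.ext (funext fun q => eq_of_forall_le_iff fun c => by
        change c ≤ boxFun P.unop.R φ.toFun (ψ.unop.toFun q) ↔
          c ≤ boxFun Q.unop.R (fun q => φ.toFun (ψ.unop.toFun q)) q
        rw [le_boxFun, le_boxFun]
        constructor
        · exact fun h y hy => h _ (ψ.unop.isPRBSHom.forth _ _ hy)
        · intro h y hy
          obtain ⟨y', hy', rfl⟩ := ψ.unop.isPRBSHom.back _ _ hy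
          exact h y' hy') }

end

end FittingModal

open FittingModal

/-!
The duality is a Stone duality in disguise, for two reasons.

On the side of spaces, the two topologies of a pairwise Boolean space coincide
(`IsPairwiseBoolean.eq`): the points of every ordered pair are separated, so a `τ₂`-compact set is
`τ₁`-closed, and the members of `β₁` and of `β₂` are compact in the join; hence they are clopen in
both topologies. On the canonical frame of an algebra the common topology is pointwise convergence
of homomorphisms to the discrete `L`, under which these form a closed subspace of the compact space
`L ^ A`.

On the side of algebras, a prime ideal `J` determines the homomorphism whose value at `a` is the
unique `l` with `T_l(a) ∉ J` (`exists_hom_of_isPrime`). With the prime ideal theorem for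
distributive lattices this gives enough homomorphisms to separate elements (`eq_of_forall_hom`), to
find successors for `R_□` (`exists_canonical_successor`, whence `□a` is computed at `ψ` as the
infimum of `a` over the successors of `ψ`), and to lift successors along a homomorphism of algebras
(`exists_comp_eq`).

For `γ`, an arrow `f` from the canonical frame to `L` takes at `h` a value in the range of `h`,
because `f` respects the subspace of that subalgebra. So `f` is locally an evaluation, and by
compactness `⋀ (T₁(cᵢ) → aᵢ)` patches finitely many of these (`exists_eval_eq`). For `ζ`,
surjectivity is a compactness argument (`IsPBS.exists_evalHom_eq`), and maps constant on a clopen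
set and off it recover the points, the subspaces `α S` and the relation (`IsPBS.eq_of_forall`,
`IsPBS.mem_α_of_forall`, `IsPRBS.rel_of_forall`).
-/

namespace FittingModal

/-! ### Homomorphisms into the truth values and prime ideals -/

section PrimeIdeals

variable {L : Type u} [HeytingAlgebra L] [Fintype L]

open Order

/-- Every prime ideal `J` of an `L`-`VL`-algebra gives a homomorphism to `L`: its value at `a` is
the unique `l` with `T_l(a) ∉ J`. -/
theorem exists_hom_of_isPrime {A : Type u} [HeytingAlgebra A] [LVLAlgebra L A] {J : Ideal A}
    (hJ : J.IsPrime) :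
    ∃ h : VLHom L A L, ∀ l a, h.toFun a = l ↔ LVLAlgebra.T l a ∉ J := by
  have htop : (⊤ : A) ∉ J := fun h => hJ.toIsProper.ne_top (Ideal.top_of_top_mem h)
  have hbot : (⊥ : A) ∈ J := J.bot_mem
  have hex (a : A) : ∃ l : L, LVLAlgebra.T l a ∉ J := by
    by_contra! hcon
    refine htop ?_
    rw [← LVLAlgebra.sup_T (L := L) a]
    exact Finset.sup_induction hbot (fun _ h₁ _ h₂ => Ideal.sup_mem h₁ h₂) fun l _ => hcon l
  choose f hf using hex
  have huniq {l : L} {a : A} (h : LVLAlgebra.T l a ∉ J) : f a = l := by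
    by_contra hne
    have h0 : LVLAlgebra.T (f a) a ⊓ LVLAlgebra.T l a ∈ J := by
      rw [LVLAlgebra.T_inf_T _ _ _ hne]; exact hbot
    exact (hJ.mem_or_mem h0).elim (hf a) h
  have hbin (a b : A) := LVLAlgebra.T_binary (f a) (f b) a b
  have hinf (a b : A) : LVLAlgebra.T (f a) a ⊓ LVLAlgebra.T (f b) b ∉ J :=
    fun h => (hJ.mem_or_mem h).elim (hf a) (hf b)
  refine ⟨⟨f, fun a b => huniq fun h => hinf a b (J.lower ((hbin a b).trans inf_le_right) h),
    fun a b => huniq fun h =>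
      hinf a b (J.lower ((hbin a b).trans (inf_le_left.trans inf_le_right)) h),
    fun a b => huniq fun h =>
      hinf a b (J.lower ((hbin a b).trans (inf_le_left.trans inf_le_left)) h),
    fun l a => huniq fun h => hf a (J.lower (LVLAlgebra.T_unary l (f a) a) h),
    huniq ?_, huniq ?_⟩, fun l a => ⟨?_, huniq⟩⟩
  · rwa [LVLAlgebra.T_bot_bot]
  · rwa [LVLAlgebra.T_top_top]
  · rintro rfl; exact hf a

theorem map_T_eq_top_iff [Nontrivial L] {A : Type u} [HeytingAlgebra A] [LVLAlgebra L A]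
    (h : VLHom L A L) {l : L} {a : A} : h.toFun (LVLAlgebra.T l a) = ⊤ ↔ h.toFun a = l := by
  rw [h.map_T]
  change charT l (h.toFun a) = ⊤ ↔ _
  by_cases e : h.toFun a = l
  · simp [e, charT_self]
  · simp [e, charT_of_ne e]

theorem VLHom.monotone {A B : Type u} [HeytingAlgebra A] [HeytingAlgebra B] [LVLAlgebra L A]
    [LVLAlgebra L B] (h : VLHom L A B) : Monotone h.toFun := fun a b hab => by
  rw [← inf_eq_left, ← h.map_inf, inf_eq_left.2 hab]

theorem map_finset_sup {A B : Type u} [HeytingAlgebra A] [HeytingAlgebra B] [LVLAlgebra L A]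
    [LVLAlgebra L B] (h : VLHom L A B) {ι : Type*} (s : Finset ι) (f : ι → A) :
    h.toFun (s.sup f) = s.sup (fun i => h.toFun (f i)) :=
  Finset.apply_sup_eq_sup_comp h.toFun h.map_sup h.map_bot

theorem map_finset_inf {A B : Type u} [HeytingAlgebra A] [HeytingAlgebra B] [LVLAlgebra L A]
    [LVLAlgebra L B] (h : VLHom L A B) {ι : Type*} (s : Finset ι) (f : ι → A) :
    h.toFun (s.inf f) = s.inf (fun i => h.toFun (f i)) :=
  Finset.apply_inf_eq_inf_comp h.toFun h.map_inf h.map_top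

theorem map_opU {A B : Type u} [HeytingAlgebra A] [HeytingAlgebra B] [LVLAlgebra L A]
    [LVLAlgebra L B] (h : VLHom L A B) (l : L) (a : A) :
    h.toFun (opU l a) = opU l (h.toFun a) := by
  simp only [opU, map_finset_sup, h.map_T]

theorem map_opU_eq_top_iff [Nontrivial L] {A : Type u} [HeytingAlgebra A] [LVLAlgebra L A]
    (h : VLHom L A L) {l : L} {a : A} : h.toFun (opU l a) = ⊤ ↔ l ≤ h.toFun a := by
  rw [map_opU, opU_self]
  split_ifs with hl <;> simp [hl]

/-- Homomorphisms to `L` separate the elements of an `L`-`VL`-algebra. -/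
theorem le_of_forall_hom {A : Type u} [HeytingAlgebra A] [LVLAlgebra L A] {a b : A}
    (hab : ∀ h : VLHom L A L, h.toFun a = h.toFun b) : a ≤ b := by
  -- if `T_l(a) ≰ T_l(b)`, a prime ideal contains `T_l(b)` but not `T_l(a)`
  have key (a b : A) (hab : ∀ h : VLHom L A L, h.toFun a = h.toFun b) (l : L) :
      LVLAlgebra.T l a ≤ LVLAlgebra.T l b := by
    by_contra hle
    obtain ⟨J, hJ, hIJ, hFJ⟩ := DistribLattice.prime_ideal_of_disjoint_filter_ideal
      (F := PFilter.principal (LVLAlgebra.T l a)) (I := Ideal.principal (LVLAlgebra.T l b))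
      (Set.disjoint_left.2 fun c h₁ h₂ =>
        hle ((PFilter.mem_principal.1 h₁).trans (Ideal.mem_principal.1 h₂)))
    obtain ⟨h, hh⟩ := exists_hom_of_isPrime (L := L) hJ
    have h₁ := (hh l a).2 (Set.disjoint_left.1 hFJ (PFilter.mem_principal.2 le_rfl))
    exact (hh l b).1 ((hab h).symm.trans h₁) (hIJ (Ideal.mem_principal.2 le_rfl))
  have h := LVLAlgebra.inf_T_le (L := L) a b
  have htop : Finset.univ.inf (fun l : L => (LVLAlgebra.T l a ⇨ LVLAlgebra.T l b) ⊓
      (LVLAlgebra.T l b ⇨ LVLAlgebra.T l a)) = ⊤ := by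
    refine top_unique (Finset.le_inf fun l _ => ?_)
    rw [himp_eq_top_iff.2 (key a b hab l),
      himp_eq_top_iff.2 (key b a (fun h => (hab h).symm) l), inf_top_eq]
  rw [htop, top_le_iff, inf_eq_top_iff] at h
  exact himp_eq_top_iff.1 h.1

theorem eq_of_forall_hom {A : Type u} [HeytingAlgebra A] [LVLAlgebra L A] {a b : A}
    (hab : ∀ h : VLHom L A L, h.toFun a = h.toFun b) : a = b :=
  le_antisymm (le_of_forall_hom hab) (le_of_forall_hom fun h => (hab h).symm)

/-! ### The canonical relation -/

theorem box_mono {A : Type u} [HeytingAlgebra A] [LMLAlgebra L A] :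
    Monotone (LMLAlgebra.box L : A → A) := fun a b hab => by
  rw [← inf_eq_left, ← LMLAlgebra.box_inf, inf_eq_left.2 hab]

theorem opU_bot {A : Type u} [HeytingAlgebra A] [LVLAlgebra L A] (a : A) :
    opU (⊥ : L) a = ⊤ := by
  classical
  rw [opU, Finset.filter_true_of_mem fun _ _ => bot_le]
  exact LVLAlgebra.sup_T a

theorem box_top {A : Type u} [HeytingAlgebra A] [LMLAlgebra L A] :
    LMLAlgebra.box L (⊤ : A) = ⊤ := by
  rw [← opU_bot (L := L) (⊤ : A), LMLAlgebra.box_opU, opU_bot, opU_bot]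

variable [Nontrivial L]

/-- The existence lemma for `R_□`: if no `c` in the ideal `I` satisfies `ψ(□c) = 1`, then `ψ` has
a successor coming from a prime ideal that contains `I`. -/
theorem exists_canonical_successor (A : MA L) (ψ : VLHom L A.carrier L) (I : Ideal A.carrier)
    (hI : ∀ c ∈ I, ψ.toFun (LMLAlgebra.box L c) ≠ ⊤) :
    ∃ φ : VLHom L A.carrier L, (canonicalFrame A).R ψ φ ∧
      ∀ l a, LVLAlgebra.T l a ∈ I → φ.toFun a ≠ l := by
  have hF : IsPFilter {c | ψ.toFun (LMLAlgebra.box L c) = ⊤} := by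
    refine IsPFilter.of_def ⟨⊤, ?_⟩ ?_ ?_
    · change ψ.toFun (LMLAlgebra.box L ⊤) = ⊤
      rw [box_top, ψ.map_top]
    · intro a ha b hb
      refine ⟨a ⊓ b, ?_, inf_le_left, inf_le_right⟩
      change ψ.toFun (LMLAlgebra.box L (a ⊓ b)) = ⊤
      rw [LMLAlgebra.box_inf, ψ.map_inf, inf_eq_top_iff]
      exact ⟨ha, hb⟩
    · intro a b hab ha
      exact top_unique (ge_trans (ψ.monotone (box_mono hab)) (ge_of_eq ha))
  obtain ⟨J, hJ, hIJ, hFJ⟩ := DistribLattice.prime_ideal_of_disjoint_filter_ideal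
    (F := hF.toPFilter) (I := I) (Set.disjoint_left.2 fun c h₁ h₂ => hI c h₂ h₁)
  obtain ⟨φ, hφ⟩ := exists_hom_of_isPrime (L := L) hJ
  refine ⟨φ, fun l a hl => ?_, fun l a hla he => (hφ l a).1 he (hIJ hla)⟩
  rw [← map_opU_eq_top_iff, ← LMLAlgebra.box_opU] at hl
  have hJa : opU l a ∉ J := Set.disjoint_left.1 hFJ hl
  by_contra hle
  classical
  refine hJa (Finset.sup_induction (p := (· ∈ J)) J.bot_mem
    (fun _ h₁ _ h₂ => Ideal.sup_mem h₁ h₂) fun l' hl' => ?_)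
  by_contra hT
  exact hle ((Finset.mem_filter.1 hl').2.trans_eq ((hφ l' a).2 hT).symm)

/-- The value of `□a` at `ψ` is the infimum of the values of `a` at the successors of `ψ`. -/
theorem le_map_box_iff (A : MA L) (ψ : VLHom L A.carrier L) (l : L) (a : A.carrier) :
    l ≤ ψ.toFun (LMLAlgebra.box L a) ↔
      ∀ φ : VLHom L A.carrier L, (canonicalFrame A).R ψ φ → l ≤ φ.toFun a := by
  refine ⟨fun h φ hφ => hφ l a h, fun h => ?_⟩
  by_contra hl
  obtain ⟨φ, hφ, hφI⟩ := exists_canonical_successor A ψ (Ideal.principal (opU l a))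
    (fun c hc htop => hl <| by
      rw [← map_opU_eq_top_iff, ← LMLAlgebra.box_opU]
      exact top_unique (ge_trans (ψ.monotone (box_mono (Ideal.mem_principal.1 hc)))
        (ge_of_eq htop)))
  refine hφI (φ.toFun a) a (Ideal.mem_principal.2 ?_) rfl
  classical
  exact Finset.le_sup (f := fun l' : L => LVLAlgebra.T l' a)
    (Finset.mem_filter.2 ⟨Finset.mem_univ _, h φ hφ⟩)

theorem map_box_eq_boxFun (A : MA L) (ψ : VLHom L A.carrier L) (a : A.carrier) :
    ψ.toFun (LMLAlgebra.box L a) = boxFun (canonicalFrame A).R (fun φ => φ.toFun a) ψ :=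
  eq_of_forall_le_iff fun l => (le_map_box_iff A ψ l a).trans le_boxFun.symm

/-- Successors of a homomorphism with values in `S` have values in `S`. -/
theorem canonical_α_succ (A : MA L) (S : SubAlg L) {ψ φ : VLHom L A.carrier L}
    (hψ : ψ ∈ (canonicalFrame A).α S) (h : (canonicalFrame A).R ψ φ) :
    φ ∈ (canonicalFrame A).α S := by
  intro a
  -- every homomorphism sends `T_l(a) → a` to `l` or to `1`, so `ψ(□(T_l(a) → a)) = l`
  set l := φ.toFun a with hl
  have hval (χ : VLHom L A.carrier L) : χ.toFun (LVLAlgebra.T l a ⇨ a) =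
      charT l (χ.toFun a) ⇨ χ.toFun a := by
    rw [χ.map_himp, χ.map_T]; rfl
  have hbox : ψ.toFun (LMLAlgebra.box L (LVLAlgebra.T l a ⇨ a)) = l := by
    refine eq_of_forall_le_iff fun c => ?_
    rw [le_map_box_iff]
    constructor
    · intro hc
      have := hc φ h
      rwa [hval, ← hl, charT_self, top_himp] at this
    · intro hc χ _
      rw [hval]
      by_cases e : χ.toFun a = l
      · rwa [e, charT_self, top_himp]
      · rw [charT_of_ne e, bot_himp]; exact le_top
  have hmem : ψ.toFun (LMLAlgebra.box L (LVLAlgebra.T l a ⇨ a)) ∈ S.carrier := hψ _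
  rwa [hbox] at hmem

end PrimeIdeals

/-! ### Pairwise Boolean spaces -/

section PairwiseBoolean

variable {X : Type u} {t₁ t₂ : TopologicalSpace X}

theorem PairwiseHausdorff.symm (h : PairwiseHausdorff t₁ t₂) : PairwiseHausdorff t₂ t₁ :=
  fun x y hxy =>
    let ⟨U, V, hU, hV, hx, hy, hd⟩ := h y x hxy.symm
    ⟨V, U, hV, hU, hy, hx, hd.symm⟩

theorem IsPairwiseBoolean.symm (h : IsPairwiseBoolean t₁ t₂) : IsPairwiseBoolean t₂ t₁ where
  hausdorff := h.hausdorff.symm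
  zeroDimensional := h.zeroDimensional.symm
  compact := by
    have := h.compact
    rwa [IsPairwiseCompact, joinTop, inf_comm] at this

/-- A `t₂`-compact set is `t₁`-closed in a pairwise Hausdorff space. -/
theorem PairwiseHausdorff.isClosed_of_isCompact (h : PairwiseHausdorff t₁ t₂) {K : Set X}
    (hK : @IsCompact X t₂ K) : IsClosed[t₁] K := by
  rw [← @isOpen_compl_iff X K t₁, @isOpen_iff_forall_mem_open X t₁ Kᶜ]
  intro x hx
  have : ∃ U : Set X, IsOpen[t₁] U ∧ x ∈ U ∧ Disjoint U K := by
    refine @IsCompact.induction_on X t₂ K hK (fun s => ∃ U : Set X, IsOpen[t₁] U ∧ x ∈ U ∧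
      Disjoint U s) ⟨Set.univ, @isOpen_univ X t₁, trivial, disjoint_bot_right⟩ ?_ ?_ ?_
    · rintro s s' hs ⟨U, hU, hxU, hd⟩
      exact ⟨U, hU, hxU, hd.mono_right hs⟩
    · rintro s s' ⟨U, hU, hxU, hd⟩ ⟨U', hU', hxU', hd'⟩
      exact ⟨U ∩ U', @IsOpen.inter X t₁ U U' hU hU', ⟨hxU, hxU'⟩, Set.disjoint_union_right.2
        ⟨hd.mono_left Set.inter_subset_left, hd'.mono_left Set.inter_subset_right⟩⟩
    · intro y hy
      obtain ⟨U, V, hU, hV, hxU, hyV, hd⟩ := h x y (fun e => hx (e ▸ hy))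
      exact ⟨V, @mem_nhdsWithin_of_mem_nhds X t₂ _ _ _ (@IsOpen.mem_nhds X t₂ y V hV hyV),
        U, hU, hxU, hd⟩
  obtain ⟨U, hU, hxU, hd⟩ := this
  exact ⟨U, hd.subset_compl_right, hU, hxU⟩

/-- A set in `β₁` is compact in the join, hence `t₂`-compact and so `t₁`-closed. -/
theorem IsPairwiseBoolean.isClosed_of_mem_beta (h : IsPairwiseBoolean t₁ t₂) {C : Set X}
    (hC : C ∈ beta t₁ t₂) : IsClosed[t₁] C := by
  refine h.hausdorff.isClosed_of_isCompact ?_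
  have hcl : IsClosed[t₁ ⊓ t₂] C := IsClosed.mono hC.2 inf_le_right
  have hcpt : @IsCompact X (t₁ ⊓ t₂) C :=
    @IsCompact.of_isClosed_subset X (t₁ ⊓ t₂) _ _ h.compact hcl (Set.subset_univ C)
  have := @IsCompact.image X X (t₁ ⊓ t₂) t₂ C id hcpt (continuous_id_of_le inf_le_right)
  rwa [Set.image_id] at this

theorem IsPairwiseBoolean.le (h : IsPairwiseBoolean t₁ t₂) : t₂ ≤ t₁ := by
  rw [@TopologicalSpace.IsTopologicalBasis.eq_generateFrom X t₁ _ h.zeroDimensional.1]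
  refine le_generateFrom fun C hC => ?_
  -- the complement of `C` is `t₂`-open and `t₁`-closed
  have hC' : Cᶜ ∈ beta t₂ t₁ := ⟨hC.2.isOpen_compl, (@isClosed_compl_iff X t₁ C).2 hC.1⟩
  exact (@isClosed_compl_iff X t₂ C).1 (h.symm.isClosed_of_mem_beta hC')

/-- The two topologies of a pairwise Boolean space coincide. -/
theorem IsPairwiseBoolean.eq (h : IsPairwiseBoolean t₁ t₂) : t₁ = t₂ :=
  le_antisymm h.symm.le h.le

theorem mem_beta_self_iff [t : TopologicalSpace X] {C : Set X} : C ∈ beta t t ↔ IsClopen C :=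
  and_comm

theorem isPairwiseBoolean_self [t : TopologicalSpace X] [CompactSpace X] [T2Space X]
    [TotallyDisconnectedSpace X] : IsPairwiseBoolean t t where
  hausdorff _ _ hxy := t2_separation hxy
  zeroDimensional := by
    have : beta t t = {s : Set X | IsClopen s} := Set.ext fun _ => mem_beta_self_iff
    rw [PairwiseZeroDimensional, this]
    exact ⟨isTopologicalBasis_isClopen, isTopologicalBasis_isClopen⟩
  compact := by
    rw [IsPairwiseCompact, joinTop, inf_idem]; exact isCompact_univ

end PairwiseBoolean

/-! ### The space of homomorphisms into the truth values -/

section HomSpace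

variable {L : Type u} [HeytingAlgebra L] [Fintype L]

/-- The topology of pointwise convergence on the homomorphisms to `L`, where `L` is discrete. -/
instance homTopology {A : Type u} [HeytingAlgebra A] [LVLAlgebra L A] :
    TopologicalSpace (VLHom L A L) :=
  .induced (fun h => h.toFun) (@Pi.topologicalSpace A (fun _ => L) fun _ => ⊥)

section

variable {A : Type u} [HeytingAlgebra A] [LVLAlgebra L A]

theorem VLHom.toFun_injective : Function.Injective (fun h : VLHom L A L => h.toFun) :=
  fun _ _ h => VLHom.ext h

theorem continuous_eval (a : A) :
    Continuous[homTopology, ⊥] (fun h : VLHom L A L => h.toFun a) := by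
  let : TopologicalSpace L := ⊥
  exact (continuous_apply a).comp continuous_induced_dom

theorem isClopen_eval (a : A) (s : Set L) : IsClopen {h : VLHom L A L | h.toFun a ∈ s} := by
  let : TopologicalSpace L := ⊥
  have : DiscreteTopology L := ⟨rfl⟩
  exact (isClopen_discrete s).preimage (continuous_eval a)

/-- The homomorphisms form a closed subset of the product `L ^ A`. -/
instance : CompactSpace (VLHom L A L) := by
  let : TopologicalSpace L := ⊥
  have : DiscreteTopology L := ⟨rfl⟩
  have hemb : IsEmbedding (fun h : VLHom L A L => h.toFun) := ⟨⟨rfl⟩, VLHom.toFun_injective⟩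
  have hrange : Set.range (fun h : VLHom L A L => h.toFun) =
      {f | ∀ a b, f (a ⊔ b) = f a ⊔ f b} ∩ {f | ∀ a b, f (a ⊓ b) = f a ⊓ f b} ∩
      {f | ∀ a b, f (a ⇨ b) = f a ⇨ f b} ∩
      {f | ∀ (l : L) a, f (LVLAlgebra.T l a) = LVLAlgebra.T l (f a)} ∩
      {f | f ⊥ = ⊥} ∩ {f | f ⊤ = ⊤} := by
    ext f
    constructor
    · rintro ⟨h, rfl⟩
      exact ⟨⟨⟨⟨⟨h.map_sup, h.map_inf⟩, h.map_himp⟩, h.map_T⟩, h.map_bot⟩, h.map_top⟩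
    · rintro ⟨⟨⟨⟨⟨h₁, h₂⟩, h₃⟩, h₄⟩, h₅⟩, h₆⟩
      exact ⟨⟨f, h₁, h₂, h₃, h₄, h₅, h₆⟩, rfl⟩
  have hbin (op : A → A → A) (op' : L → L → L) :
      IsClosed {f : A → L | ∀ a b, f (op a b) = op' (f a) (f b)} := by
    simp only [Set.ofPred_forall]
    refine isClosed_iInter fun a => isClosed_iInter fun b =>
      isClosed_eq (continuous_apply _) ?_
    have hab : Continuous fun f : A → L => (f a, f b) :=
      (continuous_apply a).prodMk (continuous_apply b)
    exact (continuous_of_discreteTopology (f := fun p : L × L => op' p.1 p.2)).comp hab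
  have hclosed : IsClosed (Set.range (fun h : VLHom L A L => h.toFun)) := by
    rw [hrange]
    refine (((((hbin _ _).inter (hbin _ _)).inter (hbin _ _)).inter ?_).inter
      (isClosed_eq (continuous_apply _) continuous_const)).inter
      (isClosed_eq (continuous_apply _) continuous_const)
    simp only [Set.ofPred_forall]
    exact isClosed_iInter fun l => isClosed_iInter fun a => isClosed_eq (continuous_apply _)
      (continuous_of_discreteTopology.comp (continuous_apply a))
  exact (IsClosedEmbedding.mk hemb hclosed).compactSpace

instance : TotallySeparatedSpace (VLHom L A L) := by
  refine totallySeparatedSpace_iff_exists_isClopen.2 fun g h hgh => ?_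
  obtain ⟨a, ha⟩ : ∃ a, g.toFun a ≠ h.toFun a := by
    by_contra! hcon
    exact hgh (VLHom.ext (funext hcon))
  exact ⟨_, isClopen_eval a {g.toFun a}, rfl, fun e => ha e.symm⟩

theorem map_himp_bot_eq_top_iff [Nontrivial L] (h : VLHom L A L) {l : L} {a : A} :
    h.toFun (LVLAlgebra.T l a ⇨ ⊥) = ⊤ ↔ h.toFun a ≠ l := by
  rw [h.map_himp, h.map_bot, himp_eq_top_iff, le_bot_iff, h.map_T]
  change charT l (h.toFun a) = ⊥ ↔ _
  by_cases e : h.toFun a = l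
  · simp [e, charT_self]
  · simp [e, charT_of_ne e]

theorem le_homTopology {t : TopologicalSpace (VLHom L A L)}
    (h : ∀ (a : A) (l : L), IsOpen[t] {h | h.toFun a = l}) : t ≤ homTopology := by
  let : TopologicalSpace L := ⊥
  have : DiscreteTopology L := ⟨rfl⟩
  refine continuous_iff_le_induced.1 (continuous_pi fun a => continuous_discrete_rng.2 fun l => ?_)
  exact h a l

end

variable [Nontrivial L]

theorem canonicalFrame_t₁ (A : MA L) : (canonicalFrame A).t₁ = homTopology := by
  refine le_antisymm (le_homTopology fun a l => ?_) (le_generateFrom ?_)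
  · refine TopologicalSpace.isOpen_generateFrom_of_mem ⟨LVLAlgebra.T l a, ?_⟩
    ext h; exact (map_T_eq_top_iff h).symm
  · rintro _ ⟨a, rfl⟩
    exact (isClopen_eval a {⊤}).2

/-- Both topologies of the canonical frame are the topology of pointwise convergence, since the
complement of `⟨T_l(a)⟩` is `⟨T_l(a) → 0⟩`. -/
theorem canonicalFrame_t₂ (A : MA L) : (canonicalFrame A).t₂ = homTopology := by
  refine le_antisymm (le_homTopology fun a l => ?_) (le_generateFrom ?_)
  · refine TopologicalSpace.isOpen_generateFrom_of_mem ⟨LVLAlgebra.T l a ⇨ ⊥, ?_⟩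
    ext h
    exact not_iff_not.1 (by rw [Set.mem_compl_iff, not_not]; exact
      (map_himp_bot_eq_top_iff h).symm)
  · rintro _ ⟨a, rfl⟩
    exact (isClopen_eval a {⊤}).compl.2

theorem isPairwiseClosed_canonicalFrame (A : MA L) {C : Set (VLHom L A.carrier L)}
    (hC : IsClosed C) : IsPairwiseClosed (canonicalFrame A).t₁ (canonicalFrame A).t₂ C := by
  rw [← canonicalFrame_t₁] at hC
  exact IsClosed.mono hC inf_le_left

theorem canonicalFrame_isPBS (A : MA L) : IsPBS (canonicalFrame A).toSpaceData where
  boolean := by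
    rw [canonicalFrame_t₁, canonicalFrame_t₂]
    exact @isPairwiseBoolean_self (VLHom L A.carrier L) homTopology _ _ _
  closed S := by
    refine isPairwiseClosed_canonicalFrame A (C := {h | ∀ a, h.toFun a ∈ S.carrier}) ?_
    rw [Set.ofPred_forall]
    exact isClosed_iInter fun a => (isClopen_eval a S.carrier).1
  α_top := Set.eq_univ_of_forall fun _ _ => trivial
  α_inf _ _ := Set.ext fun _ => forall_and

/-- The sets `⟨a⟩ = {g | g(a) = 1}` form a basis of the space of homomorphisms. -/
theorem exists_subset_of_isOpen (A : MA L) {U : Set (VLHom L A.carrier L)} (hU : IsOpen U)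
    {h : VLHom L A.carrier L} (hh : h ∈ U) :
    ∃ a, h.toFun a = ⊤ ∧ ∀ g : VLHom L A.carrier L, g.toFun a = ⊤ → g ∈ U := by
  have hb := TopologicalSpace.isTopologicalBasis_of_subbasis_of_inter
    (canonicalFrame_t₁ A).symm (by
      rintro _ ⟨a, rfl⟩ _ ⟨b, rfl⟩
      refine ⟨a ⊓ b, Set.ext fun g => ?_⟩
      change g.toFun a = ⊤ ∧ g.toFun b = ⊤ ↔ g.toFun (a ⊓ b) = ⊤
      rw [g.map_inf, inf_eq_top_iff])
  obtain ⟨V, hV, hhV, hVU⟩ := hb.exists_subset_of_mem_open hh hU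
  rcases hV with rfl | ⟨a, rfl⟩
  · exact ⟨⊤, h.map_top, fun g _ => hVU trivial⟩
  · exact ⟨a, hhV, fun g hg => hVU hg⟩

/-- The subalgebra of `L` formed by the values of a homomorphism. -/
def rangeSubAlg {A : Type u} [HeytingAlgebra A] [LVLAlgebra L A] (h : VLHom L A L) :
    SubAlg L where
  carrier := Set.range h.toFun
  sup_mem := by rintro _ ⟨a, rfl⟩ _ ⟨b, rfl⟩; exact ⟨a ⊔ b, h.map_sup a b⟩
  inf_mem := by rintro _ ⟨a, rfl⟩ _ ⟨b, rfl⟩; exact ⟨a ⊓ b, h.map_inf a b⟩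
  himp_mem := by rintro _ ⟨a, rfl⟩ _ ⟨b, rfl⟩; exact ⟨a ⇨ b, h.map_himp a b⟩
  T_mem := by rintro l _ ⟨a, rfl⟩; exact ⟨LVLAlgebra.T l a, h.map_T l a⟩
  bot_mem := ⟨⊥, h.map_bot⟩
  top_mem := ⟨⊤, h.map_top⟩

/-- Every arrow from the canonical frame to `L` is the evaluation at an element of the algebra. -/
theorem exists_eval_eq (A : MA L) (f : ValMap (canonicalFrame A).toSpaceData) :
    ∃ a : A.carrier, ∀ h : VLHom L A.carrier L, h.toFun a = f.toFun h := by
  -- the values of `f` at `h` lie in the range of `h`, so `f` is locally an evaluation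
  have hloc (h : VLHom L A.carrier L) : ∃ a c : A.carrier, h.toFun c = ⊤ ∧
      ∀ g : VLHom L A.carrier L, g.toFun c = ⊤ → g.toFun a = f.toFun g := by
    obtain ⟨a, ha⟩ : f.toFun h ∈ (rangeSubAlg h).carrier :=
      f.isPBSHom.map_α (rangeSubAlg h) h fun a => ⟨a, rfl⟩
    have hf : IsOpen {g : VLHom L A.carrier L | f.toFun g = f.toFun h} := by
      have hc : Continuous[homTopology, ⊥] f.toFun :=
        canonicalFrame_t₁ A ▸ f.isPBSHom.continuous₁
      let : TopologicalSpace L := ⊥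
      exact IsOpen.preimage hc (show IsOpen {f.toFun h} from trivial)
    obtain ⟨c, hc, hcU⟩ := exists_subset_of_isOpen A
      (((isClopen_eval a {f.toFun h}).2).inter hf) ⟨ha, rfl⟩
    exact ⟨a, c, hc, fun g hg => (hcU g hg).1.trans (hcU g hg).2.symm⟩
  choose a c hc hac using hloc
  obtain ⟨s, hs⟩ := isCompact_univ.elim_finite_subcover
    (fun h : VLHom L A.carrier L => {g : VLHom L A.carrier L | g.toFun (c h) = ⊤})
    (fun h => (isClopen_eval (c h) {⊤}).2) (fun h _ => Set.mem_iUnion.2 ⟨h, hc h⟩)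
  -- the local evaluations are patched by `⋀ (T₁(c) → a)`
  refine ⟨s.inf fun h => LVLAlgebra.T (⊤ : L) (c h) ⇨ a h, fun g => ?_⟩
  rw [map_finset_inf]
  have hval (h : VLHom L A.carrier L) : g.toFun (LVLAlgebra.T (⊤ : L) (c h) ⇨ a h) =
      charT ⊤ (g.toFun (c h)) ⇨ g.toFun (a h) := by
    rw [g.map_himp, g.map_T]; rfl
  simp only [hval]
  refine le_antisymm ?_ (Finset.le_inf fun h _ => ?_)
  · obtain ⟨h, hhs, hg⟩ := Set.mem_iUnion₂.1 (hs (Set.mem_univ g))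
    refine (Finset.inf_le hhs).trans ?_
    have hg' : g.toFun (c h) = ⊤ := hg
    rw [hg', charT_self, top_himp, hac h g hg']
  · by_cases hg : g.toFun (c h) = ⊤
    · rw [hg, charT_self, top_himp, hac h g hg]
    · rw [charT_of_ne hg, bot_himp]; exact le_top

/-- The map with value `l` on a clopen set `C` and `l'` elsewhere is an arrow to `L` if `l` lies in
`S` whenever `C` meets `α S`, and `l'` lies in every subalgebra. -/
theorem isPBSHom_ite {L : Type u} [HeytingAlgebra L] {B : SpaceData L} (hB : B.t₁ = B.t₂)
    {C : Set B.carrier} [∀ x, Decidable (x ∈ C)] (hC : @IsClopen _ B.t₁ C) (l l' : L)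
    (hl : ∀ S : SubAlg L, (C ∩ B.α S).Nonempty → l ∈ S.carrier)
    (hl' : ∀ S : SubAlg L, l' ∈ S.carrier) :
    IsPBSHom B (valueSpace L) (fun x => if x ∈ C then l else l') := by
  have hcont : Continuous[B.t₁, ⊥] (fun x => if x ∈ C then l else l') := by
    let := B.t₁
    let : TopologicalSpace L := ⊥
    refine continuous_const.if (fun x hx => ?_) continuous_const
    exact absurd hx (by rw [Set.ofPred_mem_eq, hC.frontier_eq]; exact id)
  refine ⟨hcont, hB ▸ hcont, fun S x hx => ?_⟩
  dsimp only
  split_ifs with h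
  · exact hl S ⟨x, h, hx⟩
  · exact hl' S

end HomSpace

/-! ### Canonical frames are relational pairwise Boolean spaces -/

section CanonicalFrame

variable {L : Type u} [HeytingAlgebra L] [Fintype L] [Nontrivial L]

theorem mem_beta_canonicalFrame_iff (A : MA L) {C : Set (VLHom L A.carrier L)} :
    C ∈ beta (canonicalFrame A).t₁ (canonicalFrame A).t₂ ↔ IsClopen C := by
  rw [canonicalFrame_t₁, canonicalFrame_t₂]
  exact mem_beta_self_iff (X := VLHom L A.carrier L)

/-- Every clopen set of the canonical frame has the form `⟨a⟩`. -/
theorem exists_eq_of_isClopen (A : MA L) {C : Set (VLHom L A.carrier L)} (hC : IsClopen C) :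
    ∃ a : A.carrier, C = {h | h.toFun a = ⊤} := by
  classical
  have hC' : @IsClopen (VLHom L A.carrier L) (canonicalFrame A).t₁ C :=
    canonicalFrame_t₁ A ▸ hC
  obtain ⟨a, ha⟩ := exists_eval_eq A
    ⟨_, isPBSHom_ite (B := (canonicalFrame A).toSpaceData)
      ((canonicalFrame_t₁ A).trans (canonicalFrame_t₂ A).symm) hC' ⊤ ⊥
      (fun S _ => S.top_mem) (fun S => S.bot_mem)⟩
  refine ⟨a, Set.ext fun h => ?_⟩
  have hval : h.toFun a = if h ∈ C then ⊤ else ⊥ := ha h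
  change h ∈ C ↔ h.toFun a = ⊤
  rw [hval]
  by_cases hh : h ∈ C <;> simp [hh]

/-- `[R_□]` of a clopen set is clopen, because `[R_□]⟨a⟩ = ⟨□a⟩`. -/
theorem isClopen_boxSet (A : MA L) {C : Set (VLHom L A.carrier L)} (hC : IsClopen C) :
    IsClopen {ψ : VLHom L A.carrier L | ∀ φ : VLHom L A.carrier L,
      (canonicalFrame A).R ψ φ → φ ∈ C} := by
  obtain ⟨a, rfl⟩ := exists_eq_of_isClopen A hC
  have : {ψ : VLHom L A.carrier L | ∀ φ : VLHom L A.carrier L,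
      (canonicalFrame A).R ψ φ → φ ∈ {h : VLHom L A.carrier L | h.toFun a = ⊤}} =
      {h : VLHom L A.carrier L | h.toFun (LMLAlgebra.box L a) ∈ ({⊤} : Set L)} := by
    ext ψ
    have := le_map_box_iff A ψ ⊤ a
    simp only [top_le_iff] at this
    exact this.symm
  rw [this]
  exact isClopen_eval _ _

theorem diaSet_eq {X : Type u} (R : X → X → Prop) (C : Set X) :
    diaSet R C = (boxSet R Cᶜ)ᶜ := by
  ext p
  exact ⟨fun ⟨q, hq, hqC⟩ h => h hq hqC, fun h => by
    obtain ⟨q, hq, hqC⟩ := Set.not_subset.1 h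
    exact ⟨q, hq, not_not.1 hqC⟩⟩

theorem canonicalFrame_isPRBS (A : MA L) : IsPRBS (canonicalFrame A) where
  isPBS := canonicalFrame_isPBS A
  compact ψ := by
    have hcl : IsPairwiseClosed (canonicalFrame A).t₁ (canonicalFrame A).t₂
        {φ | (canonicalFrame A).R ψ φ} := by
      refine isPairwiseClosed_canonicalFrame A (C := {φ | ∀ (l : L) (a : A.carrier),
        l ≤ ψ.toFun (LMLAlgebra.box L a) → φ.toFun a ∈ Set.Ici l}) ?_
      simp only [Set.ofPred_forall]
      exact isClosed_iInter fun l => isClosed_iInter fun a => isClosed_iInter fun _ =>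
        (isClopen_eval a (Set.Ici l)).1
    exact @IsCompact.of_isClosed_subset _ (joinTop _ _) _ _
      (canonicalFrame_isPBS A).boolean.compact hcl (Set.subset_univ _)
  box_mem C hC := (mem_beta_canonicalFrame_iff A).2
    (isClopen_boxSet A ((mem_beta_canonicalFrame_iff A).1 hC))
  dia_mem C hC := by
    rw [diaSet_eq]
    exact (mem_beta_canonicalFrame_iff A).2
      (isClopen_boxSet A ((mem_beta_canonicalFrame_iff A).1 hC).compl).compl
  α_succ S _ hm _ h := canonical_α_succ A S hm h

open Order in
/-- The back condition for composition with `ψ`: a successor `χ` of `φ ∘ ψ` extends along `ψ` to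
a successor of `φ`. -/
theorem exists_comp_eq {A B : MA L} (ψ : MLHom L A.carrier B.carrier) (φ : VLHom L B.carrier L)
    (χ : VLHom L A.carrier L) (h : (canonicalFrame A).R (φ.comp ψ.toVLHom) χ) :
    ∃ φ' : VLHom L B.carrier L, (canonicalFrame B).R φ φ' ∧ φ'.comp ψ.toVLHom = χ := by
  -- the ideal generated by the image of `{a | χ(a) = 0}`
  have hI : IsIdeal {c : B.carrier | ∃ a, χ.toFun a = ⊥ ∧ c ≤ ψ.toFun a} := by
    refine ⟨fun c d hdc ⟨a, ha, hc⟩ => ⟨a, ha, hdc.trans hc⟩, ⟨⊥, ⊥, χ.map_bot, bot_le⟩, ?_⟩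
    rintro c ⟨a, ha, hc⟩ d ⟨b, hb, hd⟩
    exact ⟨ψ.toFun (a ⊔ b), ⟨a ⊔ b, by rw [χ.map_sup, ha, hb, sup_bot_eq], le_rfl⟩,
      hc.trans (ψ.monotone le_sup_left), hd.trans (ψ.monotone le_sup_right)⟩
  obtain ⟨φ', hφ', hne⟩ := exists_canonical_successor B φ hI.toIdeal (by
    rintro c ⟨a, ha, hc⟩ htop
    have h1 : φ.toFun (ψ.toFun (LMLAlgebra.box L a)) = ⊤ := by
      rw [ψ.map_box]
      exact top_unique (ge_trans (φ.monotone (box_mono hc)) (ge_of_eq htop))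
    have h2 := h ⊤ a (ge_of_eq h1)
    rw [ha] at h2
    exact bot_ne_top (top_unique h2))
  refine ⟨φ', hφ', VLHom.ext (funext fun a => ?_)⟩
  change φ'.toFun (ψ.toFun a) = χ.toFun a
  by_contra he
  refine hne (φ'.toFun (ψ.toFun a)) (ψ.toFun a) ⟨LVLAlgebra.T _ a, ?_, (ψ.map_T _ a).ge⟩ rfl
  rw [χ.map_T]
  exact charT_of_ne fun e => he e.symm

theorem canonicalMap_isPRBSHom {A B : MA L} (ψ : A ⟶ B) :
    IsPRBSHom (canonicalFrame B) (canonicalFrame A) (canonicalMap ψ) where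
  isPBSHom :=
    { continuous₁ := by
        let := (canonicalFrame B).t₁
        refine continuous_generateFrom_iff.2 ?_
        rintro _ ⟨a, rfl⟩
        exact TopologicalSpace.isOpen_generateFrom_of_mem ⟨(MLHom.toVLHom ψ).toFun a, rfl⟩
      continuous₂ := by
        let := (canonicalFrame B).t₂
        refine continuous_generateFrom_iff.2 ?_
        rintro _ ⟨a, rfl⟩
        exact TopologicalSpace.isOpen_generateFrom_of_mem ⟨(MLHom.toVLHom ψ).toFun a, rfl⟩
      map_α := fun _ _ hx a => hx _ }
  forth φ φ' h l a hl := by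
    refine h l ((MLHom.toVLHom ψ).toFun a) ?_
    rw [← MLHom.map_box ψ]
    exact hl
  back φ χ h := exists_comp_eq ψ φ χ h

end CanonicalFrame

/-! ### Evaluation at the points of a space -/

section Evaluation

variable {L : Type u} [HeytingAlgebra L]

theorem preimage_mem_beta {B : SpaceData L} (f : ValMap B) (s : Set L) :
    f.toFun ⁻¹' s ∈ beta B.t₁ B.t₂ := by
  have h₁ : Continuous[B.t₁, ⊥] f.toFun := f.isPBSHom.continuous₁
  have h₂ : Continuous[B.t₂, ⊥] f.toFun := f.isPBSHom.continuous₂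
  let : TopologicalSpace L := ⊥
  have : DiscreteTopology L := ⟨rfl⟩
  exact ⟨@IsOpen.preimage _ _ B.t₁ _ _ h₁ s (isOpen_discrete s),
    @IsClosed.preimage _ _ B.t₂ _ _ h₂ s (isClosed_discrete s)⟩

/-- If every arrow to `L` has a value in `S` at `p`, then `p ∈ α S`. With `M` the least subalgebra
such that `p ∈ α M`, every `l ∈ M` is the value at `p` of an arrow that is `⊤` off a small clopen
neighbourhood of `p`; hence `M ⊆ S`. -/
theorem IsPBS.mem_α_of_forall [Finite L] {B : SpaceData L} (hB : IsPBS B) {S : SubAlg L}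
    {p : B.carrier} (h : ∀ f : ValMap B, f.toFun p ∈ S.carrier) : p ∈ B.α S := by
  classical
  have hfin : Finite (SubAlg L) :=
    Finite.of_injective SubAlg.carrier fun _ _ => SubAlg.ext
  have hclosed (S : SubAlg L) : IsClosed[B.t₁] (B.α S) := by
    have := hB.closed S
    rwa [IsPairwiseClosed, joinTop, ← hB.boolean.eq, inf_idem] at this
  have hmono {S S' : SubAlg L} (hS : S.carrier ⊆ S'.carrier) : B.α S ⊆ B.α S' := by
    have : S ⊓ S' = S := SubAlg.ext (Set.inter_eq_left.2 hS)
    have h' := hB.α_inf S S'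
    rw [this] at h'
    exact Set.inter_eq_left.1 h'.symm
  -- the least subalgebra `M` with `p ∈ α M`
  obtain ⟨M, hpM, hM⟩ : ∃ M : SubAlg L, p ∈ B.α M ∧
      ∀ S : SubAlg L, p ∈ B.α S → M.carrier ⊆ S.carrier := by
    obtain ⟨M, hM, hmin⟩ := Set.Finite.exists_minimalFor SubAlg.carrier
      {S : SubAlg L | p ∈ B.α S} (Set.toFinite _)
      ⟨⊤, by change p ∈ B.α ⊤; rw [hB.α_top]; trivial⟩
    refine ⟨M, hM, fun S hS => ?_⟩
    have hMS : M ⊓ S ∈ {S : SubAlg L | p ∈ B.α S} := by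
      change p ∈ B.α (M ⊓ S); rw [hB.α_inf]; exact ⟨hM, hS⟩
    exact fun x hx => (hmin hMS Set.inter_subset_left hx).2
  refine hmono (fun l hl => ?_) hpM
  -- a clopen neighbourhood of `p` that misses every `α S'` not containing `p`
  have hopen : IsOpen[B.t₁] (⋂ S' : {S' : SubAlg L // p ∉ B.α S'}, (B.α S')ᶜ) := by
    let := B.t₁
    exact isOpen_iInter_of_finite fun S' => (hclosed S').isOpen_compl
  obtain ⟨C, hC, hpC, hCU⟩ := @TopologicalSpace.IsTopologicalBasis.exists_subset_of_mem_open _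
    B.t₁ _ hB.boolean.zeroDimensional.1 _ _ (Set.mem_iInter.2 fun S' => S'.2) hopen
  have := h ⟨_, isPBSHom_ite hB.boolean.eq ⟨hB.boolean.isClosed_of_mem_beta hC, hC.1⟩ l ⊤
    (fun S' ⟨q, hqC, hqS'⟩ => hM S' (by
      by_contra hp
      exact Set.mem_iInter.1 (hCU hqC) ⟨S', hp⟩ hqS') hl) (fun S' => S'.top_mem)⟩
  simpa [hpC] using this

/-- The arrow to `L` with value `⊤` on the clopen set `C` and `⊥` elsewhere. -/
theorem IsPBS.exists_valMap {B : SpaceData L} (hB : IsPBS B) [Nontrivial L] {C : Set B.carrier}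
    (hC : C ∈ beta B.t₁ B.t₂) : ∃ f : ValMap B, (∀ x, f.toFun x = ⊤ ↔ x ∈ C) ∧
      ∀ x, f.toFun x = ⊥ ↔ x ∉ C := by
  classical
  refine ⟨⟨_, isPBSHom_ite hB.boolean.eq ⟨hB.boolean.isClosed_of_mem_beta hC, hC.1⟩ ⊤ ⊥
    (fun S _ => S.top_mem) (fun S => S.bot_mem)⟩, fun x => ?_, fun x => ?_⟩ <;>
  by_cases hx : x ∈ C <;> simp [hx]

/-- Arrows to `L` separate the points of a space. -/
theorem IsPBS.eq_of_forall [Nontrivial L] {B : SpaceData L} (hB : IsPBS B) {p q : B.carrier}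
    (h : ∀ f : ValMap B, f.toFun p = f.toFun q) : p = q := by
  by_contra hpq
  obtain ⟨U, V, hU, -, hpU, hqV, hd⟩ := hB.boolean.hausdorff p q hpq
  obtain ⟨C, hC, hpC, hCU⟩ := @TopologicalSpace.IsTopologicalBasis.exists_subset_of_mem_open _
    B.t₁ _ hB.boolean.zeroDimensional.1 _ _ hpU hU
  obtain ⟨f, hf, -⟩ := hB.exists_valMap hC
  exact Set.disjoint_left.1 hd (hCU ((hf q).1 ((h f).symm.trans ((hf p).2 hpC)))) hqV

variable [Fintype L]

/-- Evaluation at a point, as a homomorphism to `L`. -/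
def evalHom (B : SpaceData L) (p : B.carrier) : VLHom L (ValMap B) L where
  toFun f := f.toFun p
  map_sup _ _ := rfl
  map_inf _ _ := rfl
  map_himp _ _ := rfl
  map_T _ _ := rfl
  map_bot := rfl
  map_top := rfl

variable [Nontrivial L]

/-- Every homomorphism from the algebra of a space to `L` is the evaluation at a point: otherwise,
by compactness, finitely many of the elements `T_{h(f)}(f)`, which `h` maps to `1`, would have
infimum `0`. -/
theorem IsPBS.exists_evalHom_eq {B : SpaceData L} (hB : IsPBS B) (h : VLHom L (ValMap B) L) :
    ∃ p, evalHom B p = h := by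
  by_contra! hcon
  have hex (p : B.carrier) : ∃ f : ValMap B, f.toFun p ≠ h.toFun f := by
    by_contra! hp
    exact hcon p (VLHom.ext (funext hp))
  choose f hf using hex
  have hopen (g : ValMap B) : IsOpen[joinTop B.t₁ B.t₂] {q | g.toFun q ≠ h.toFun g} :=
    IsOpen.mono (preimage_mem_beta g {h.toFun g}ᶜ).1 inf_le_left
  let := joinTop B.t₁ B.t₂
  have hcpt : IsCompact (Set.univ : Set B.carrier) := hB.boolean.compact
  obtain ⟨s, hs⟩ := hcpt.elim_finite_subcover (fun p => {q | (f p).toFun q ≠ h.toFun (f p)}) (fun p => hopen (f p))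
    (fun p _ => Set.mem_iUnion.2 ⟨p, hf p⟩)
  have h0 : s.inf (fun p => LVLAlgebra.T (h.toFun (f p)) (f p)) = ⊥ := by
    refine ValMap.ext (funext fun q => ?_)
    rw [ValMap.inf_apply]
    obtain ⟨p, hps, hq⟩ := Set.mem_iUnion₂.1 (hs (Set.mem_univ q))
    refine bot_unique ((Finset.inf_le hps).trans ?_)
    exact (charT_of_ne (L := L) hq).le
  have h1 : h.toFun (s.inf fun p => LVLAlgebra.T (h.toFun (f p)) (f p)) = ⊤ := by
    rw [map_finset_inf]
    refine top_unique (Finset.le_inf fun p _ => ?_)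
    exact ge_of_eq ((map_T_eq_top_iff h).2 rfl)
  rw [h0, h.map_bot] at h1
  exact bot_ne_top h1

/-- The relation of a space is determined by the modal operation on its algebra. -/
theorem IsPRBS.rel_of_forall {P : FrameData L} (hP : IsPRBS P) {p q : P.carrier}
    (h : ∀ f : ValMap P.toSpaceData, boxFun P.R f.toFun p = ⊤ → f.toFun q = ⊤) : P.R p q := by
  by_contra hpq
  have hB := hP.isPBS.boolean
  have hcpt : @IsCompact _ P.t₂ {q | P.R p q} := by
    have := @IsCompact.image _ _ (P.t₁ ⊓ P.t₂) P.t₂ _ id (hP.compact p)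
      (continuous_id_of_le inf_le_right)
    rwa [Set.image_id] at this
  have hcl : IsClosed[P.t₁] {q | P.R p q} := hB.hausdorff.isClosed_of_isCompact hcpt
  obtain ⟨C, hC, hqC, hCU⟩ := @TopologicalSpace.IsTopologicalBasis.exists_subset_of_mem_open _
    P.t₁ _ hB.zeroDimensional.1 _ _ (show q ∈ {q | P.R p q}ᶜ from hpq) hcl.isOpen_compl
  obtain ⟨f, hf, hf0⟩ := hP.isPBS.exists_valMap hC
  -- `f → ⊥` is `⊤` on the successors of `p`, but not at `q`
  have htop := h (f ⇨ ⊥) (top_unique (le_boxFun.2 fun y hy => by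
    change ⊤ ≤ f.toFun y ⇨ ⊥
    rw [(hf0 y).2 fun hyC => hCU hyC hy, himp_self]))
  change f.toFun q ⇨ ⊥ = ⊤ at htop
  rw [(hf q).2 hqC, top_himp] at htop
  exact bot_ne_top htop

end Evaluation

/-! ### The natural isomorphisms -/

section NaturalIsomorphisms

variable {L : Type u} [HeytingAlgebra L] [Fintype L]

/-- A bijective homomorphism of `L`-`ML`-algebras is an isomorphism. -/
noncomputable def MA.isoOfBijective {A B : MA L} (f : MLHom L A.carrier B.carrier)
    (hf : Function.Bijective f.toFun) : A ≅ B where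
  hom := f
  inv :=
    let g := (Equiv.ofBijective f.toFun hf).symm
    have hg (b : B.carrier) : f.toFun (g b) = b := (Equiv.ofBijective f.toFun hf).apply_symm_apply b
    (show MLHom L B.carrier A.carrier from
    { toFun := g
      map_sup := fun a b => hf.1 (by rw [f.map_sup, hg, hg, hg])
      map_inf := fun a b => hf.1 (by rw [f.map_inf, hg, hg, hg])
      map_himp := fun a b => hf.1 (by rw [f.map_himp, hg, hg, hg])
      map_T := fun l a => hf.1 (by rw [f.map_T, hg, hg])
      map_bot := hf.1 (by rw [f.map_bot, hg])
      map_top := hf.1 (by rw [f.map_top, hg])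
      map_box := fun a => hf.1 (by rw [f.map_box]; simp only [hg]) })
  hom_inv_id := MLHom.ext (funext fun a => (Equiv.ofBijective f.toFun hf).symm_apply_apply a)
  inv_hom_id := MLHom.ext (funext fun b => (Equiv.ofBijective f.toFun hf).apply_symm_apply b)

variable [Nontrivial L]

/-- The map `γ^A(a)`, evaluation at `a`, is an arrow from the canonical frame to `L`. -/
theorem isPBSHom_eval (A : MA L) (a : A.carrier) :
    IsPBSHom (canonicalFrame A).toSpaceData (valueSpace L)
      (fun g : VLHom L A.carrier L => g.toFun a) where
  continuous₁ := by rw [canonicalFrame_t₁]; exact continuous_eval a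
  continuous₂ := by rw [canonicalFrame_t₂]; exact continuous_eval a
  map_α _ _ hg := hg a

variable (hobj : ∀ A : MA L, IsPRBS (canonicalFrame A))
  (hmap : ∀ (A B : MA L) (ψ : A ⟶ B),
    IsPRBSHom (canonicalFrame B) (canonicalFrame A) (canonicalMap ψ))

/-- The homomorphism `γ^A`, `γ^A(a)(g) = g(a)`. -/
noncomputable def gammaHom (A : MA L) :
    MLHom L A.carrier (((functorG hobj hmap).rightOp ⋙ functorF L).obj A).carrier where
  toFun a := ⟨fun g : VLHom L A.carrier L => g.toFun a, isPBSHom_eval A a⟩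
  map_sup a b := ValMap.ext (funext fun g => VLHom.map_sup g a b)
  map_inf a b := ValMap.ext (funext fun g => VLHom.map_inf g a b)
  map_himp a b := ValMap.ext (funext fun g => VLHom.map_himp g a b)
  map_T l a := ValMap.ext (funext fun g => VLHom.map_T g l a)
  map_bot := ValMap.ext (funext fun g => VLHom.map_bot g)
  map_top := ValMap.ext (funext fun g => VLHom.map_top g)
  map_box a := ValMap.ext (funext fun g => map_box_eq_boxFun A g a)

theorem gammaHom_bijective (A : MA L) : Function.Bijective (gammaHom hobj hmap A).toFun :=
  ⟨fun _ _ h => eq_of_forall_hom fun g => congrFun (congrArg ValMap.toFun h) g,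
    fun f => (exists_eval_eq A f).imp fun _ ha => ValMap.ext (funext ha)⟩

/-- The natural isomorphism `γ`. -/
noncomputable def gammaIso : 𝟭 (MA L) ≅ (functorG hobj hmap).rightOp ⋙ functorF L :=
  NatIso.ofComponents
    (fun A => MA.isoOfBijective (gammaHom hobj hmap A) (gammaHom_bijective hobj hmap A))
    (fun _ => rfl)

theorem evalHom_bijective {B : SpaceData L} (hB : IsPBS B) :
    Function.Bijective (evalHom B) :=
  ⟨fun _ _ h => hB.eq_of_forall fun f => congrFun (congrArg VLHom.toFun h) f,
    hB.exists_evalHom_eq⟩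

/-- The algebra of arrows from a space to `L`. -/
noncomputable abbrev valAlg (P : PRBS L) : MA L where
  carrier := ValMap P.toSpaceData

theorem evalHom_rel_iff (P : PRBS L) {p q : P.carrier} :
    (canonicalFrame (valAlg P)).R (evalHom _ p) (evalHom _ q) ↔ P.R p q := by
  refine ⟨fun h => P.isPRBS.rel_of_forall fun f hf => ?_, fun h l f hl => ?_⟩
  · exact top_unique (h ⊤ f (ge_of_eq hf))
  · exact le_boxFun.1 hl q h

theorem evalHom_isPRBSHom (P : PRBS L) :
    IsPRBSHom P.toFrameData (canonicalFrame (valAlg P)) (evalHom P.toSpaceData) where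
  isPBSHom :=
    { continuous₁ := by
        let := P.t₁
        refine continuous_generateFrom_iff.2 ?_
        rintro _ ⟨f, rfl⟩
        exact (preimage_mem_beta f {⊤}).1
      continuous₂ := by
        let := P.t₂
        refine continuous_generateFrom_iff.2 ?_
        rintro _ ⟨f, rfl⟩
        exact (preimage_mem_beta f {⊤}).2.isOpen_compl
      map_α := fun S p hp f => f.isPBSHom.map_α S p hp }
  forth _ _ := (evalHom_rel_iff P).2
  back p h hR := by
    obtain ⟨q, rfl⟩ := P.isPRBS.isPBS.exists_evalHom_eq h
    exact ⟨q, (evalHom_rel_iff P).1 hR, rfl⟩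

/-- The preimage of a member of `β₁` under the inverse of `evalHom` is clopen. -/
theorem isClopen_preimage_inverse {B : SpaceData L} (hB : IsPBS B)
    {g : VLHom L (ValMap B) L → B.carrier} (hg : ∀ h, evalHom B (g h) = h) {C : Set B.carrier}
    (hC : C ∈ beta B.t₁ B.t₂) : IsClopen (g ⁻¹' C) := by
  obtain ⟨f, hf, -⟩ := hB.exists_valMap hC
  convert isClopen_eval (A := ValMap B) f {⊤} using 1
  ext h
  have hval : f.toFun (g h) = h.toFun f := congrArg (fun h => VLHom.toFun h f) (hg h)
  change g h ∈ C ↔ h.toFun f = ⊤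
  rw [← hf, hval]

theorem inverse_isPRBSHom (P : PRBS L) {g : VLHom L (ValMap P.toSpaceData) L → P.carrier}
    (hg : ∀ h, evalHom P.toSpaceData (g h) = h) (hg' : ∀ p, g (evalHom P.toSpaceData p) = p) :
    IsPRBSHom (canonicalFrame (valAlg P)) P.toFrameData g where
  isPBSHom :=
    { continuous₁ := by
        rw [canonicalFrame_t₁, @TopologicalSpace.IsTopologicalBasis.eq_generateFrom _ P.t₁ _
          P.isPRBS.isPBS.boolean.zeroDimensional.1]
        exact continuous_generateFrom_iff.2 fun C hC =>
          (isClopen_preimage_inverse P.isPRBS.isPBS hg hC).2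
      continuous₂ := by
        rw [canonicalFrame_t₂, ← P.isPRBS.isPBS.boolean.eq,
          @TopologicalSpace.IsTopologicalBasis.eq_generateFrom _ P.t₁ _
          P.isPRBS.isPBS.boolean.zeroDimensional.1]
        exact continuous_generateFrom_iff.2 fun C hC =>
          (isClopen_preimage_inverse P.isPRBS.isPBS hg hC).2
      map_α := fun S h hh => P.isPRBS.isPBS.mem_α_of_forall fun f => by
        rw [← hg h] at hh
        exact hh f }
  forth h h' hR := by
    rw [← hg h, ← hg h', evalHom_rel_iff] at hR
    exact hR
  back h q hR := ⟨evalHom _ q, by rw [← hg h, evalHom_rel_iff]; exact hR, hg' q⟩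

/-- The isomorphism `ζ_P`, `ζ_P(p)(ψ) = ψ(p)`. -/
noncomputable def zetaIsoApp (P : PRBS L) :
    P ≅ ((functorF L).rightOp ⋙ functorG hobj hmap).obj P :=
  let e := Equiv.ofBijective (evalHom P.toSpaceData) (evalHom_bijective P.isPRBS.isPBS)
  { hom := ⟨evalHom P.toSpaceData, evalHom_isPRBSHom P⟩
    inv := ⟨e.symm, inverse_isPRBSHom P e.apply_symm_apply e.symm_apply_apply⟩
    hom_inv_id := PRBSHom.ext (funext e.symm_apply_apply)
    inv_hom_id := PRBSHom.ext (funext e.apply_symm_apply) }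

/-- The natural isomorphism `ζ`. -/
noncomputable def zetaIso : 𝟭 (PRBS L) ≅ (functorF L).rightOp ⋙ functorG hobj hmap :=
  NatIso.ofComponents (fun P => zetaIsoApp hobj hmap P) (fun _ => rfl)

/-- The equivalence formed by `𝒢` and `ℱ`. -/
noncomputable def dualEquivalence : (MA L)ᵒᵖ ≌ PRBS L :=
  CategoryTheory.Equivalence.mk (functorG hobj hmap) (functorF L).rightOp
    (NatIso.ofComponents (fun A => ((gammaIso hobj hmap).app A.unop).symm.op)
      (fun f => Quiver.Hom.unop_inj ((gammaIso hobj hmap).inv.naturality f.unop).symm))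
    (zetaIso hobj hmap).symm

end NaturalIsomorphisms

end FittingModal

theorem theorem3 (L : Type u) [HeytingAlgebra L] [Fintype L] [Nontrivial L] :
    ∃ (hobj : ∀ A : MA L, IsPRBS (canonicalFrame A))
      (hmap : ∀ (A B : MA L) (ψ : A ⟶ B),
        IsPRBSHom (canonicalFrame B) (canonicalFrame A) (canonicalMap ψ)),
      (∃ e : (MA L)ᵒᵖ ≌ PRBS L,
        e.functor = functorG hobj hmap ∧ e.inverse = (functorF L).rightOp) ∧
      (∃ γ : 𝟭 (MA L) ≅ (functorG hobj hmap).rightOp ⋙ functorF L,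
        ∀ (A : MA L) (a : A.carrier) (g : VLHom L A.carrier L),
          ((γ.hom.app A).toFun a).toFun g = g.toFun a) ∧
      (∃ ζ : 𝟭 (PRBS L) ≅ (functorF L).rightOp ⋙ functorG hobj hmap,
        ∀ (P : PRBS L) (p : P.carrier) (ψ : ValMap P.toSpaceData),
          ((ζ.hom.app P).toFun p).toFun ψ = ψ.toFun p) :=
  ⟨canonicalFrame_isPRBS, fun _ _ => canonicalMap_isPRBSHom,
    ⟨dualEquivalence canonicalFrame_isPRBS fun _ _ => canonicalMap_isPRBSHom, rfl, rfl⟩,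
    ⟨gammaIso _ _, fun _ _ _ => rfl⟩,
    ⟨zetaIso _ _, fun _ _ _ => rfl⟩⟩
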